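/- **Setting.** Let $\mathcal H$ be a real Hilbert space, and let $N$ agents be the vertices of a connected graph $\mathcal G$. Let $W\in\mathbb R^{N\times N}$ be a gossip matrix of $\mathcal G$: nonnegative, symmetric, doubly stochastic, with $W_{ii}>0$, $W_{ij}>0$ if $\{i,j\}$ is an edge, and $W_{ij}=0$ if $i\ne j$ and $\{i,j\}$ is not an edge. A *zero-mean contraction factor* of $W$ is a number $\rho\in[0,1)$ with $\|Wz\|_2\le\rho\|z\|_2$ for all $z\in\mathbb R^N$ with $\sum_n z_n=0$. A *compressor* with coefficient $\alpha\in[0,1)$ is a (measurable) map $\mathcal C:\Xi\times\mathcal H\to\mathcal H$ on a probability space $(\Xi,\nu)$ with $\mathbb E_{\omega\sim\nu}\|\mathcal C(\omega,v)-v\|^2\le\alpha\|v\|^2$ for all $v\in\mathcal H$. For $\varepsilon>0$, $t\in\mathbb N$ put $$F^{\mathrm{KT}}_t(x)=\varepsilon\,\frac{2^t\,\Gamma(\frac{t+1}2+\frac x2)\,\Gamma(\frac{t+1}2-\frac x2)}{\pi\,t!},\qquad F^{\mathrm{SE}}_t(x)=\frac{\varepsilon}{\sqrt{t+1}}\exp\Big(\frac{x^2}{2(t+1)}\Big).$$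 For $F\in\{F^{\mathrm{KT}},F^{\mathrm{SE}}\}$ and $t\ge1$ let $\beta_t(x)=\frac{F_t(x+1)-F_t(x-1)}{F_t(x+1)+F_t(x-1)}$, $h_t(x)=\beta_t(x)F_{t-1}(x)$, and $\mathrm{Bet}_t(G)=\frac{h_t(\|G\|)}{\|G\|}G$ for $G\ne0$, $\mathrm{Bet}_t(0)=0$. Let $\mathrm{clip}_t(G)=G$ if $\|G\|\le t$ and $\frac t{\|G\|}G$ otherwise. **Algorithm** (potential $F$, step size $\gamma$, schedule $q:\mathbb N\to\mathbb N$). Start from $G_{n,0}=\widehat G_{n,0}=0$. In round $t=0,1,\dots$ agent $n$ predicts $x_{n,t}=\mathrm{Bet}_{t+1}(\mathrm{clip}_t(G_{n,t}))$, a convex $1$-Lipschitz loss $\ell_{n,t}:\mathcal H\to\mathbb R$ is revealed, and the agent takes $g_{n,t}\in\partial\ell_{n,t}(x_{n,t})$ and sets $Z^0_n=G_{n,t}-g_{n,t}$, $\widehat Z^0_n=\widehat G_{n,t}$. For $k=0,\dots,q(t)-1$, $$\widehat Z^{k+1}_n=\widehat Z^k_n+\mathcal C(\omega^k_{n,t},Z^k_n-\widehat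 Z^k_n),\qquad Z^{k+1}_n=Z^k_n+\gamma\sum_{j=1}^N W_{nj}(\widehat Z^{k+1}_j-\widehat Z^{k+1}_n),$$ and then $G_{n,t+1}=Z_n^{q(t)}$, $\widehat G_{n,t+1}=\widehat Z_n^{q(t)}$. Let $\mathcal F_t$ be the history before the compressor randomness of round $t$. The losses and subgradients of round $t$ are $\mathcal F_t$-measurable (in particular they may be deterministic, or chosen adaptively). Each seed $\omega^k_{n,t}$ has law $\nu$ and is independent of the history before substep $k$ of round $t$, which is generated by $\mathcal F_t$ and the seeds of the earlier substeps of that round; the seeds of round $t$ are $\mathcal F_{t+1}$-measurable. With $\bar\ell_t=\frac1N\sum_n\ell_{n,t}$, the network regret against $u\in\mathcal H$ is $$R^{\mathrm{net}}_T(u)=\sum_{t=0}^{T-1}\frac1N\sum_{n=1}^N\bar\ell_t(x_{n,t})-\sum_{t=0}^{T-1}\bar\ell_t(u).$$ **Statement.** The matrix $W$ has a zero-mean contraction factor $\rho\in[0,1)$. Let $\rho$ be any such factor, put $\mu=1-\rho$, let $$0<\gamma\le\min\Big\{1,\frac{1-\sqrt\alpha}{2\sqrt\alpha\,(1+4/\mu)+\mu/2}\Big\},\qquad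 \bar\eta=1-\frac{\gamma\mu}2,\qquad q(t)=\lceil ct\rceil,$$ and define, for $P\in\{\mathrm{KT},\mathrm{SE}\}$, $$C_{\mathrm{sched}}^{\mathrm{KT}}=48\Big((\varepsilon+1)\big(1+\tfrac2{\log2}\big)+1\Big),\quad C_{\mathrm{sched}}^{\mathrm{SE}}=4e^{3/2}(2\varepsilon+1),\quad C_{\mathrm{reg}}^{P}=3\Big(2+\frac\mu4\Big)\frac{C_{\mathrm{sched}}^{P}}2\sqrt N .$$ (a) If the KT potential is used and $c\ge-\frac{2\log2}{\log\bar\eta}$, then for all $u\in\mathcal H$ and all integers $T\ge1$ the network regret is integrable and $$\mathbb E R_T^{\mathrm{net}}(u)\le\|u\|\sqrt{2(T+1)}\sqrt{\log\Big(1+\frac{2e^2\pi T(T+1)\|u\|^2}{\varepsilon^2}\Big)}+\varepsilon\Big(1-\frac1{e\sqrt{\pi T}}\Big)+C_{\mathrm{reg}}^{\mathrm{KT}}\sqrt T .$$ (b) If the shifted-exponential potential is used and $c\ge-\frac{3}{2\log\bar\eta}$, then for all $u\in\mathcal H$ and all integers $T\ge1$ the network regret is integrable and $$\mathbb E R_T^{\mathrm{net}}(u)\le\|u\|\sqrt{(T+1)\log\Big(1+\frac{(T+1)^2\|u\|^2}{\varepsilon^2}\Big)}+\varepsilon\Big(1-\frac1{\sqrt{T+1}}\Big)+C_{\mathrm{reg}}^{\mathrm{SE}}\sqrt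 T .$$ The expectation is over the randomness of the run. -/

import Mathlib

open MeasureTheory ProbabilityTheory
open scoped BigOperators Nat RealInnerProductSpace

noncomputable section

/-! ### Coin-betting potentials and predictions -/

/-- The Krichevsky-Trofimov potential with endowment `ε`. -/
def ktPotential (ε : ℝ) (t : ℕ) (x : ℝ) : ℝ :=
  ε * (2 ^ t * Real.Gamma (((t : ℝ) + 1) / 2 + x / 2) * Real.Gamma (((t : ℝ) + 1) / 2 - x / 2))
    / (Real.pi * (t ! : ℝ))

/-- The shifted-exponential potential with endowment `ε`. -/
def sePotential (ε : ℝ) (t : ℕ) (x : ℝ) : ℝ :=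
  ε / Real.sqrt ((t : ℝ) + 1) * Real.exp (x ^ 2 / (2 * ((t : ℝ) + 1)))

/-- The betting fraction `β_t(x)` of a family of potentials. -/
def betFraction (F : ℕ → ℝ → ℝ) (t : ℕ) (x : ℝ) : ℝ :=
  (F t (x + 1) - F t (x - 1)) / (F t (x + 1) + F t (x - 1))

/-- The coin-betting function `h_t(x) = β_t(x) F_{t-1}(x)`; it is only used for `t ≥ 1`. -/
def coinBet (F : ℕ → ℝ → ℝ) (t : ℕ) (x : ℝ) : ℝ :=
  betFraction F t x * F (t - 1) x

section Hilbert

variable {H : Type*} [NormedAddCommGroup H] [InnerProductSpace ℝ H]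

/-- The radial map `Bet_t(G) = h_t(‖G‖) G / ‖G‖`, which is `0` at `G = 0`. -/
def radialBet (F : ℕ → ℝ → ℝ) (t : ℕ) (G : H) : H :=
  (coinBet F t ‖G‖ / ‖G‖) • G

/-- Norm clipping at radius `t`. -/
def normClip (t : ℕ) (G : H) : H :=
  if ‖G‖ ≤ (t : ℝ) then G else ((t : ℝ) / ‖G‖) • G

/-- `g` is a subgradient of `f` at `x`. -/
def IsSubgradientAt (f : H → ℝ) (g x : H) : Prop :=
  ∀ y : H, f x + ⟪g, y - x⟫ ≤ f y

end Hilbert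

/-! ### Communication graph and compression -/

/-- A gossip matrix of the graph `𝒢`: nonnegative, doubly stochastic, symmetric, with
off-diagonal support exactly the edge set, and with positive self-weights. -/
structure IsGossipMatrix {N : ℕ} (𝒢 : SimpleGraph (Fin N)) (W : Matrix (Fin N) (Fin N) ℝ) :
    Prop where
  doublyStoch : W ∈ doublyStochastic ℝ (Fin N)
  symm : W.IsSymm
  pos_of_adj : ∀ i j, 𝒢.Adj i j → 0 < W i j
  zero_of_not_adj : ∀ i j, i ≠ j → ¬ 𝒢.Adj i j → W i j = 0
  self_pos : ∀ i, 0 < W i i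

/-- `ρ ∈ [0,1)` is a zero-mean contraction factor of `W` in the `ℓ²` norm of `ℝ^N`. -/
structure IsContractionFactor {N : ℕ} (W : Matrix (Fin N) (Fin N) ℝ) (ρ : ℝ) : Prop where
  nonneg : 0 ≤ ρ
  lt_one : ρ < 1
  contracts : ∀ z : Fin N → ℝ, ∑ n, z n = 0 →
    Real.sqrt (∑ n, (∑ j, W n j * z j) ^ 2) ≤ ρ * Real.sqrt (∑ n, (z n) ^ 2)

/-- A randomized compressor on `H` with sample space `(Ξ, ν)` and mean-square residual
coefficient `α ∈ [0,1)`.  The measurability clause is joint measurability on `Ξ × S` for every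
separable `S ⊆ H`; for separable `H` this is joint Borel measurability on `Ξ × H`. -/
structure IsCompressor {H : Type*} [NormedAddCommGroup H] [MeasurableSpace H]
    {Ξ : Type*} [MeasurableSpace Ξ] (ν : Measure Ξ) (C : Ξ → H → H) (α : ℝ) : Prop where
  nonneg : 0 ≤ α
  lt_one : α < 1
  measurable : ∀ S : Set H, TopologicalSpace.IsSeparable S →
    StronglyMeasurable (fun p : Ξ × S => C p.1 (p.2 : H))
  residual : ∀ v : H,
    ∫⁻ s, ENNReal.ofReal (‖C s v - v‖ ^ 2) ∂ν ≤ ENNReal.ofReal (α * ‖v‖ ^ 2)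

/-! ### The algorithm -/

section Algorithm

variable {H : Type*} [NormedAddCommGroup H] [InnerProductSpace ℝ H] {Ξ : Type*} {N : ℕ}

/-- One compressed gossip substep applied to (clean states, trackers); `s n` is the compressor
seed of agent `n`. -/
def gossipSubstep (W : Matrix (Fin N) (Fin N) ℝ) (γ : ℝ) (C : Ξ → H → H) (s : Fin N → Ξ)
    (p : (Fin N → H) × (Fin N → H)) : (Fin N → H) × (Fin N → H) :=
  let Y : Fin N → H := fun n => p.2 n + C (s n) (p.1 n - p.2 n)
  (fun n => p.1 n + γ • ∑ j, W n j • (Y j - Y n), Y)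

/-- The result of the first `k` gossip substeps; `s j n` is the seed of agent `n` at substep
`j`. -/
def gossipLoop (W : Matrix (Fin N) (Fin N) ℝ) (γ : ℝ) (C : Ξ → H → H) (s : ℕ → Fin N → Ξ)
    (p : (Fin N → H) × (Fin N → H)) : ℕ → (Fin N → H) × (Fin N → H)
  | 0 => p
  | k + 1 => gossipSubstep W γ C (s k) (gossipLoop W γ C s p k)

/-- The pair (clean states `G_t`, trackers `Ĝ_t`) at the beginning of round `t`, where `g t n` is
the subgradient of agent `n` in round `t` and `s t k n` the seed of agent `n` at substep `k` of
round `t`. -/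
def decoState (W : Matrix (Fin N) (Fin N) ℝ) (γ : ℝ) (q : ℕ → ℕ) (C : Ξ → H → H)
    (s : ℕ → ℕ → Fin N → Ξ) (g : ℕ → Fin N → H) : ℕ → (Fin N → H) × (Fin N → H)
  | 0 => (fun _ => 0, fun _ => 0)
  | t + 1 =>
    gossipLoop W γ C (s t)
      (fun n => (decoState W γ q C s g t).1 n + -g t n, (decoState W γ q C s g t).2) (q t)

/-- The prediction `x_{n,t} = Bet_{t+1}(clip_t(G_{n,t}))`. -/
def decoPrediction (F : ℕ → ℝ → ℝ) (W : Matrix (Fin N) (Fin N) ℝ) (γ : ℝ) (q : ℕ → ℕ)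
    (C : Ξ → H → H) (s : ℕ → ℕ → Fin N → Ξ) (g : ℕ → Fin N → H) (t : ℕ) (n : Fin N) : H :=
  radialBet F (t + 1) (normClip t ((decoState W γ q C s g t).1 n))

/-- The network loss. -/
def networkLoss (l : ℕ → Fin N → H → ℝ) (t : ℕ) (x : H) : ℝ :=
  (1 / (N : ℝ)) * ∑ n, l t n x

/-- The network regret of the predictions `x` against the comparator `u` after `T` rounds. -/
def networkRegret (l : ℕ → Fin N → H → ℝ) (x : ℕ → Fin N → H) (T : ℕ) (u : H) : ℝ :=
  (∑ t ∈ Finset.range T, (1 / (N : ℝ)) * ∑ n, networkLoss l t (x t n))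
    - ∑ t ∈ Finset.range T, networkLoss l t u

/-- A randomized run of the algorithm on the probability space `(Ω, P)`.

`𝓕 t` is the history before the compressor randomness of round `t`.  The losses `l t n` and the
subgradients `g t n` of round `t` may depend on this history.  The seed `ξ t k n` used by agent
`n` at substep `k < q t` has law `ν` and is independent of the history before that substep, which
consists of `𝓕 t` and of all seeds of the earlier substeps of round `t`. -/
structure IsDecoRun [MeasurableSpace Ξ] (ν : Measure Ξ) {Ω : Type*} {mΩ : MeasurableSpace Ω}
    (P : Measure Ω) (𝓕 : Filtration ℕ mΩ) (F : ℕ → ℝ → ℝ) (W : Matrix (Fin N) (Fin N) ℝ) (γ : ℝ)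
    (q : ℕ → ℕ) (C : Ξ → H → H) (ξ : ℕ → ℕ → Fin N → Ω → Ξ) (l : ℕ → Fin N → Ω → H → ℝ)
    (g : ℕ → Fin N → Ω → H) : Prop where
  seed_law : ∀ t, ∀ k < q t, ∀ n, MeasurePreserving (ξ t k n) P ν
  seed_fresh : ∀ t, ∀ k < q t, ∀ n,
    Indep (MeasurableSpace.comap (ξ t k n) inferInstance)
      (𝓕 t ⊔ ⨆ j : Fin k, ⨆ m : Fin N, MeasurableSpace.comap (ξ t j m) inferInstance) P
  seed_revealed : ∀ t, ∀ k < q t, ∀ n, Measurable[𝓕 (t + 1)] (ξ t k n)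
  loss_convex : ∀ t n ω, ConvexOn ℝ Set.univ (l t n ω)
  loss_lipschitz : ∀ t n ω, LipschitzWith 1 (l t n ω)
  loss_measurable : ∀ t n x, Measurable[𝓕 t] (fun ω => l t n ω x)
  grad_measurable : ∀ t n, StronglyMeasurable[𝓕 t] (g t n)
  grad_subgradient : ∀ t n ω,
    IsSubgradientAt (l t n ω) (g t n ω)
      (decoPrediction F W γ q C (fun t k n => ξ t k n ω) (fun t n => g t n ω) t n)

/-- The network regret of a run, as a random variable. -/
def decoRegret {Ω : Type*} (F : ℕ → ℝ → ℝ) (W : Matrix (Fin N) (Fin N) ℝ) (γ : ℝ)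
    (q : ℕ → ℕ) (C : Ξ → H → H) (ξ : ℕ → ℕ → Fin N → Ω → Ξ) (l : ℕ → Fin N → Ω → H → ℝ)
    (g : ℕ → Fin N → Ω → H) (T : ℕ) (u : H) (ω : Ω) : ℝ :=
  networkRegret (fun t n => l t n ω)
    (decoPrediction F W γ q C (fun t k n => ξ t k n ω) (fun t n => g t n ω)) T u

end Algorithm

/-! ### Parameters and constants -/

/-- The linear gossip schedule `q(t) = ⌈c t⌉`. -/
def linearSchedule (c : ℝ) (t : ℕ) : ℕ := ⌈c * (t : ℝ)⌉₊

/-- The upper limit for the communication step size, with spectral gap `μ = 1 - ρ`. -/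
def maxStepSize (α ρ : ℝ) : ℝ :=
  min 1 ((1 - Real.sqrt α) / (2 * Real.sqrt α * (1 + 4 / (1 - ρ)) + (1 - ρ) / 2))

/-- The effective tracker rate `1 - γ μ / 2`, with `μ = 1 - ρ`. -/
def trackerRate (γ ρ : ℝ) : ℝ := 1 - γ * (1 - ρ) / 2

def schedConstKT (ε : ℝ) : ℝ := 48 * ((ε + 1) * (1 + 2 / Real.log 2) + 1)

def schedConstSE (ε : ℝ) : ℝ := 4 * Real.exp (3 / 2) * (2 * ε + 1)

/-- The network constant `(2 + χ) (C_sched / 2) √N`, where `χ = (1 - ρ) / 4`. -/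
def netConst (Csched ρ : ℝ) (N : ℕ) : ℝ :=
  (2 + (1 - ρ) / 4) * (Csched / 2) * Real.sqrt N

/-- The regret constant. -/
def regConst (Csched ρ : ℝ) (N : ℕ) : ℝ := 3 * netConst Csched ρ N

end

/-!
The regret splits into the regret of one idealized bettor and the cost of disagreement.

*The idealized bettor.*  Gossip preserves averages, so the average of the clean states is the sum
of the average coins `c_t = -(1/N) ∑ g_{n,t}`, and the point `Bet_{t+1}` of this average is the
prediction of a coin bettor in `H`.  Both potentials are convex, increasing functions of the squared
argument.  Hence one round of betting with a coin `c` in the unit ball of `H` is dominated by the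
interpolation between the coins `±1` on a line, where the potential satisfies
`F_{t+1}(x + 1) + F_{t+1}(x - 1) ≤ 2 F_t(x)`; the wealth therefore stays above
`F_T(‖c_0 + ... + c_{T-1}‖)` (`IsBettingPotential.apply_norm_sum_le`).  A lower bound
`F_T(x) ≥ b exp (x² / (2a))` and the conjugate of this Gaussian (`mul_le_exp_sq_add`) turn wealth
into regret.  For the Krichevsky-Trofimov potential, convexity in the square and the Gaussian lower
bound come from Gauss' product `Γ(a + y) Γ(a - y) = lim K_n ∏ 1 / ((a + j)² - y²)`.

*Disagreement.*  Moving a loss between agents and the average costs three times the distance between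
the predictions of an agent and of the average (`networkRegret_le`).  Clipping is nonexpansive and
`Bet_{t+1}` is `L_t`-Lipschitz on the ball of radius `t` (`radial_lipschitz`), with `L_t` of order
`2^t` for the Krichevsky-Trofimov and `e^{t/2}` for the shifted-exponential potential.  The
disagreement is controlled by the Lyapunov function `‖Z - Z̄‖ + ((1 - ρ)/4) ‖Z - Ẑ‖` in `L²`.  Fresh
seeds are independent of the history, so the compressor shrinks the tracking error by `√α` in mean
square (`IsCompressor.lintegral_sq_le`), and the step size condition makes one substep contract
the Lyapunov function by `η = 1 - γ (1 - ρ)/2` (`LyapunovBound.gossipSubstep`).  A new subgradient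
adds at most `(2 + (1 - ρ)/4) √N`.  With `q(t) = ⌈c t⌉` the factor `η^{q(t)}` is at most `4^{-t}`,
respectively `e^{-3t/2}`, so `L_t` times the disagreement decays geometrically and its sum over the
rounds is bounded by a constant (`IsDecoRun.integral_decoRegret_le`).
-/

/-! ### Radial maps of a Hilbert space -/

section Radial

variable {H : Type*} [NormedAddCommGroup H] [InnerProductSpace ℝ H]

/-- A radial profile that vanishes at the origin and is `L`-Lipschitz on `[0, R]` induces a radial
map that is `L`-Lipschitz on the ball of radius `R`: by the law of cosines, with `θ` the angle
between `A` and `B`, the squared distance is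
`(h a - h b)² + 2 h(a) h(b) (1 - cos θ) ≤ L² ((a - b)² + 2 a b (1 - cos θ))`. -/
lemma radial_lipschitz {h : ℝ → ℝ} {L R : ℝ} (hL : 0 ≤ L) (h0 : h 0 = 0)
    (hlip : ∀ x y, 0 ≤ y → y ≤ x → x ≤ R → |h x - h y| ≤ L * (x - y))
    (A B : H) (hA : ‖A‖ ≤ R) (hB : ‖B‖ ≤ R) :
    ‖(h ‖A‖ / ‖A‖) • A - (h ‖B‖ / ‖B‖) • B‖ ≤ L * ‖A - B‖ := by
  have hbd : ∀ D : H, ‖D‖ ≤ R → |h ‖D‖| ≤ L * ‖D‖ := fun D hD => by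
    simpa [h0] using hlip ‖D‖ 0 le_rfl (norm_nonneg _) hD
  have hnorm : ∀ D : H, ‖(h ‖D‖ / ‖D‖) • D‖ = |h ‖D‖| := fun D => by
    by_cases hD : D = 0
    · simp [hD, h0]
    · rw [norm_smul, norm_div, norm_norm, div_mul_cancel₀ _ (norm_ne_zero_iff.2 hD),
        Real.norm_eq_abs]
  by_cases hA0 : A = 0
  · subst hA0
    simp only [smul_zero, zero_sub, norm_neg]
    rw [hnorm]; exact hbd B hB
  by_cases hB0 : B = 0
  · subst hB0
    simp only [smul_zero, sub_zero]
    rw [hnorm]; exact hbd A hA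
  have ha : 0 < ‖A‖ := norm_pos_iff.2 hA0
  have hb : 0 < ‖B‖ := norm_pos_iff.2 hB0
  have hdiff : (h ‖A‖ - h ‖B‖) ^ 2 ≤ L ^ 2 * (‖A‖ - ‖B‖) ^ 2 := by
    rw [← mul_pow, sq_le_sq, abs_mul, abs_of_nonneg hL]
    rcases le_total ‖B‖ ‖A‖ with hab | hab
    · rw [abs_of_nonneg (sub_nonneg.2 hab)]
      exact hlip _ _ hb.le hab hA
    · rw [abs_sub_comm, abs_sub_comm ‖A‖, abs_of_nonneg (sub_nonneg.2 hab)]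
      exact hlip _ _ ha.le hab hB
  have hprod : h ‖A‖ * h ‖B‖ ≤ L ^ 2 * (‖A‖ * ‖B‖) := by
    calc h ‖A‖ * h ‖B‖ ≤ |h ‖A‖ * h ‖B‖| := le_abs_self _
      _ = |h ‖A‖| * |h ‖B‖| := abs_mul _ _
      _ ≤ (L * ‖A‖) * (L * ‖B‖) := by
          gcongr
          · exact hbd A hA
          · exact hbd B hB
      _ = L ^ 2 * (‖A‖ * ‖B‖) := by ring
  obtain ⟨z, hz⟩ : ∃ z, z = ⟪A, B⟫ / (‖A‖ * ‖B‖) := ⟨_, rfl⟩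
  have hz1 : z ≤ 1 := by
    rw [hz]; exact (div_le_one (by positivity)).2 (real_inner_le_norm A B)
  have hAB : ⟪A, B⟫ = z * (‖A‖ * ‖B‖) := by rw [hz]; field_simp
  refine le_of_sq_le_sq ?_ (by positivity)
  rw [mul_pow, norm_sub_sq_real, norm_sub_sq_real, hnorm, hnorm, sq_abs, sq_abs,
    real_inner_smul_left, real_inner_smul_right, hAB]
  have e : h ‖A‖ / ‖A‖ * (h ‖B‖ / ‖B‖ * (z * (‖A‖ * ‖B‖))) = h ‖A‖ * h ‖B‖ * z := by
    field_simp
  rw [e]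
  nlinarith [mul_le_mul_of_nonneg_right hprod (sub_nonneg.2 hz1)]

lemma normClip_eq_radial (t : ℕ) (G : H) : normClip t G = (min ‖G‖ (t : ℝ) / ‖G‖) • G := by
  unfold normClip
  split_ifs with hG
  · rw [min_eq_left hG]
    by_cases h0 : G = 0
    · simp [h0]
    · rw [div_self (norm_ne_zero_iff.2 h0), one_smul]
  · rw [min_eq_right (not_le.1 hG).le]

lemma norm_normClip_le (t : ℕ) (G : H) : ‖normClip t G‖ ≤ t := by
  unfold normClip
  split_ifs with hG
  · exact hG
  · have hpos : 0 < ‖G‖ := lt_of_le_of_lt (Nat.cast_nonneg t) (not_le.1 hG)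
    rw [norm_smul, norm_div, norm_norm, div_mul_cancel₀ _ hpos.ne', Real.norm_natCast]

lemma normClip_lipschitz (t : ℕ) (A B : H) : ‖normClip t A - normClip t B‖ ≤ ‖A - B‖ := by
  rw [normClip_eq_radial, normClip_eq_radial]
  have := radial_lipschitz (h := fun r => min r (t : ℝ)) (L := 1) (R := max ‖A‖ ‖B‖) zero_le_one
    (by simp) (fun x y _ hyx _ => by
      rw [abs_of_nonneg (sub_nonneg.2 (min_le_min_right _ hyx)), one_mul]
      rcases le_total y t with hy | hy
      · rw [min_eq_left hy]; linarith [min_le_left x (t : ℝ)]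
      · rw [min_eq_right hy]; linarith [min_le_right x (t : ℝ)])
    A B (le_max_left _ _) (le_max_right _ _)
  simpa using this

end Radial

/-! ### Coin betting in a Hilbert space -/

lemma norm_sum_range_le_of_norm_le_one {H : Type*} [SeminormedAddCommGroup H] {c : ℕ → H}
    (hc : ∀ t, ‖c t‖ ≤ 1) (t : ℕ) :
    ‖∑ s ∈ Finset.range t, c s‖ ≤ t := by
  simpa using norm_sum_le_of_le (Finset.range t) (fun s _ => hc s)

/-- The properties of a family of coin-betting potentials that the regret analysis uses.  The
convexity and monotonicity are those of `F t` as a function of the *squared* wealth coordinate,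
which is what makes the one-dimensional potential argument work with norms in a Hilbert space. -/
structure IsBettingPotential (F : ℕ → ℝ → ℝ) (ε : ℝ) : Prop where
  init : F 0 0 = ε
  even : ∀ (t : ℕ) (x : ℝ), F t (-x) = F t x
  pos : ∀ (t : ℕ) (x : ℝ), |x| < (t : ℝ) + 1 → 0 < F t x
  convexOn : ∀ t : ℕ, ConvexOn ℝ (Set.Ico 0 (((t : ℝ) + 1) ^ 2)) fun w => F t √w
  monotoneOn : ∀ t : ℕ, MonotoneOn (fun w => F t √w) (Set.Ico 0 (((t : ℝ) + 1) ^ 2))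
  step : ∀ (t : ℕ) (x : ℝ), 0 ≤ x → x ≤ t → F (t + 1) (x + 1) + F (t + 1) (x - 1) ≤ 2 * F t x

namespace IsBettingPotential

variable {F : ℕ → ℝ → ℝ} {ε : ℝ}

lemma apply_abs (hF : IsBettingPotential F ε) (t : ℕ) (x : ℝ) : F t |x| = F t x := by
  rcases abs_choice x with h | h <;> rw [h]
  exact hF.even t x

lemma apply_mono (hF : IsBettingPotential F ε) (t : ℕ) {x y : ℝ} (hx : 0 ≤ x) (hxy : x ≤ y)
    (hy : y < t + 1) : F t x ≤ F t y := by
  have h := hF.monotoneOn t (a := x ^ 2) (b := y ^ 2)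
    ⟨sq_nonneg _, by nlinarith⟩ ⟨sq_nonneg _, by nlinarith⟩ (by nlinarith)
  simpa [Real.sqrt_sq hx, Real.sqrt_sq (hx.trans hxy)] using h

lemma coinBet_zero (hF : IsBettingPotential F ε) (t : ℕ) : coinBet F t 0 = 0 := by
  simp [coinBet, betFraction, hF.even]

variable {H : Type*} [NormedAddCommGroup H] [InnerProductSpace ℝ H]

/-- One round of betting: the wealth stays above the potential of the sum of the coins.  The
potential is convex and monotone in the squared norm, and `‖S + c‖²` is at most the interpolation
of `(‖S‖ + 1)²` and `(‖S‖ - 1)²` that corresponds to the component of `c` along `S`; this reduces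
the claim to coins `±1` on the line. -/
lemma apply_norm_add_le (hF : IsBettingPotential F ε) (t : ℕ) (S c : H) (hS : ‖S‖ ≤ t)
    (hc : ‖c‖ ≤ 1) :
    F (t + 1) ‖S + c‖ ≤ F t ‖S‖ + ⟪c, radialBet F (t + 1) S⟫ := by
  have ht : (0 : ℝ) ≤ t := Nat.cast_nonneg t
  by_cases hS0 : S = 0
  · subst hS0
    have h1 := hF.step t 0 le_rfl ht
    have h2 := hF.apply_mono (t + 1) (norm_nonneg c) hc (by push_cast; linarith)
    rw [zero_sub, hF.even, zero_add] at h1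
    simp only [zero_add, norm_zero, radialBet, smul_zero, inner_zero_right, add_zero]
    linarith
  have hr : 0 < ‖S‖ := norm_pos_iff.2 hS0
  obtain ⟨r, hrdef⟩ : ∃ r, r = ‖S‖ := ⟨_, rfl⟩
  obtain ⟨z, hz⟩ : ∃ z, z = ⟪c, S⟫ / ‖S‖ := ⟨_, rfl⟩
  have hzabs : |z| ≤ 1 := by
    rw [hz, abs_div, abs_norm, div_le_one hr]
    exact (abs_real_inner_le_norm c S).trans (by nlinarith)
  have hzl : -1 ≤ z := (abs_le.1 hzabs).1
  have hzu : z ≤ 1 := (abs_le.1 hzabs).2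
  have hcS : ⟪c, S⟫ = z * r := by rw [hz, hrdef]; field_simp
  have hbet : ⟪c, radialBet F (t + 1) S⟫ = z * (betFraction F (t + 1) r * F t r) := by
    rw [radialBet, real_inner_smul_right, hcS, ← hrdef, coinBet, Nat.add_sub_cancel]
    rw [← hrdef] at hr
    field_simp
  rw [hbet, ← hrdef]
  rw [← hrdef] at hr hS
  have hsq : ‖S + c‖ ^ 2 ≤ (1 + z) / 2 * (r + 1) ^ 2 + (1 - z) / 2 * (r - 1) ^ 2 := by
    rw [norm_add_sq_real, real_inner_comm, hcS, ← hrdef]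
    nlinarith [norm_nonneg c]
  have hp : (r + 1) ^ 2 ∈ Set.Ico (0 : ℝ) ((((t + 1 : ℕ) : ℝ) + 1) ^ 2) :=
    ⟨sq_nonneg _, by push_cast; nlinarith⟩
  have hm : (r - 1) ^ 2 ∈ Set.Ico (0 : ℝ) ((((t + 1 : ℕ) : ℝ) + 1) ^ 2) :=
    ⟨sq_nonneg _, by push_cast; nlinarith⟩
  have hw : (1 + z) / 2 * (r + 1) ^ 2 + (1 - z) / 2 * (r - 1) ^ 2 ∈
      Set.Ico (0 : ℝ) ((((t + 1 : ℕ) : ℝ) + 1) ^ 2) :=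
    (convex_Ico _ _) hp hm (a := (1 + z) / 2) (b := (1 - z) / 2) (by linarith) (by linarith)
      (by ring)
  have h1 := hF.monotoneOn (t + 1) ⟨sq_nonneg ‖S + c‖, hsq.trans_lt hw.2⟩ hw hsq
  have h2 := (hF.convexOn (t + 1)).2 hp hm (show 0 ≤ (1 + z) / 2 by linarith)
    (show 0 ≤ (1 - z) / 2 by linarith) (by ring)
  simp only [smul_eq_mul, Real.sqrt_sq_eq_abs, hF.apply_abs] at h1 h2
  have hA : 0 < F (t + 1) (r + 1) := hF.pos _ _ (by
    rw [abs_of_pos (by linarith)]; push_cast; linarith)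
  have hB : 0 < F (t + 1) (r - 1) := hF.pos _ _ (by
    rw [abs_lt]; push_cast; constructor <;> linarith)
  have hstep := hF.step t r hr.le hS
  have hβ : betFraction F (t + 1) r * (F (t + 1) (r + 1) + F (t + 1) (r - 1)) =
      F (t + 1) (r + 1) - F (t + 1) (r - 1) := by
    rw [betFraction]; field_simp
  have hβabs : |betFraction F (t + 1) r| ≤ 1 := by
    rw [betFraction, abs_div, abs_of_pos (add_pos hA hB), div_le_one (add_pos hA hB), abs_le]
    constructor <;> linarith
  have hβz : 0 ≤ 1 + z * betFraction F (t + 1) r := by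
    have : |z * betFraction F (t + 1) r| ≤ 1 := by
      rw [abs_mul]; exact mul_le_one₀ hzabs (abs_nonneg _) hβabs
    linarith [(abs_le.1 this).1]
  nlinarith [mul_le_mul_of_nonneg_right hstep hβz]

lemma apply_norm_sum_le (hF : IsBettingPotential F ε) {c : ℕ → H} (hc : ∀ t, ‖c t‖ ≤ 1) (T : ℕ) :
    F T ‖∑ s ∈ Finset.range T, c s‖ ≤
      ε + ∑ t ∈ Finset.range T, ⟪c t, radialBet F (t + 1) (∑ s ∈ Finset.range t, c s)⟫ := by
  induction T with
  | zero => simp [hF.init]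
  | succ T ih =>
    rw [Finset.sum_range_succ, Finset.sum_range_succ _ T]
    linarith [hF.apply_norm_add_le T _ (c T) (norm_sum_range_le_of_norm_le_one hc T) (hc T)]

end IsBettingPotential

/-- Bound on the convex conjugate of `x ↦ b exp (x² / (2a))`.  The right-hand side without the
exponential is `y m - b`, where `m` is chosen such that `exp (m² / (2a)) = √(1 + a y² / b²)`; beyond
`m` the slope of the exponential is at least `y`. -/
lemma mul_le_exp_sq_add {a b x y : ℝ} (ha : 0 < a) (hb : 0 < b) (hy : 0 ≤ y) :
    x * y ≤ b * Real.exp (x ^ 2 / (2 * a)) + y * √(a * Real.log (1 + a * y ^ 2 / b ^ 2)) - b := by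
  obtain ⟨z, hz⟩ : ∃ z, z = a * y ^ 2 / b ^ 2 := ⟨_, rfl⟩
  have hz0 : 0 ≤ z := by rw [hz]; positivity
  rw [← hz]
  have hlog : 0 ≤ Real.log (1 + z) := Real.log_nonneg (by linarith)
  obtain ⟨m, hm⟩ : ∃ m, m = √(a * Real.log (1 + z)) := ⟨_, rfl⟩
  have hm0 : 0 ≤ m := by rw [hm]; positivity
  have hmsq : m ^ 2 = a * Real.log (1 + z) := by rw [hm, Real.sq_sqrt (by positivity)]
  rw [← hm]
  have hexp1 : b ≤ b * Real.exp (x ^ 2 / (2 * a)) :=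
    le_mul_of_one_le_right hb.le (Real.one_le_exp (by positivity))
  rcases le_total x m with hxm | hxm
  · nlinarith
  obtain ⟨E, hE⟩ : ∃ E, E = Real.exp (m ^ 2 / (2 * a)) := ⟨_, rfl⟩
  have hE1 : 1 ≤ E := by rw [hE]; exact Real.one_le_exp (by positivity)
  have hEsq : E ^ 2 = 1 + z := by
    rw [hE, ← Real.exp_nat_mul, hmsq]
    have : ((2 : ℕ) : ℝ) * (a * Real.log (1 + z) / (2 * a)) = Real.log (1 + z) := by
      push_cast; field_simp
    rw [this, Real.exp_log (by linarith)]
  have hlogz : z ≤ Real.log (1 + z) * (1 + z) := by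
    have := Real.one_sub_inv_le_log_of_pos (show 0 < 1 + z by linarith)
    have h2 : (1 - (1 + z)⁻¹) * (1 + z) = z := by field_simp; ring
    nlinarith
  -- the derivative of the exponential at `m` is at least `y`
  have hslope : y ≤ b * (m / a) * E := by
    refine le_of_sq_le_sq ?_ (by positivity)
    have : (b * (m / a) * E) ^ 2 = b ^ 2 / a * (Real.log (1 + z) * (1 + z)) := by
      rw [mul_pow, mul_pow, div_pow, hmsq, hEsq]; field_simp
    rw [this]
    have hy2 : y ^ 2 = b ^ 2 / a * z := by rw [hz]; field_simp
    rw [hy2]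
    gcongr
  have hconv : E * (1 + (x - m) * (m / a)) ≤ Real.exp (x ^ 2 / (2 * a)) := by
    have h1 : (x - m) * (m / a) ≤ x ^ 2 / (2 * a) - m ^ 2 / (2 * a) := by
      rw [← sub_nonneg]
      have : x ^ 2 / (2 * a) - m ^ 2 / (2 * a) - (x - m) * (m / a) = (x - m) ^ 2 / (2 * a) := by
        field_simp; ring
      rw [this]; positivity
    have h2 := Real.add_one_le_exp (x ^ 2 / (2 * a) - m ^ 2 / (2 * a))
    calc E * (1 + (x - m) * (m / a)) ≤ E * Real.exp (x ^ 2 / (2 * a) - m ^ 2 / (2 * a)) := by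
          gcongr; linarith
      _ = Real.exp (x ^ 2 / (2 * a)) := by rw [hE, ← Real.exp_add]; congr 1; ring
  nlinarith [mul_le_mul_of_nonneg_left hconv hb.le,
    mul_le_mul_of_nonneg_left hslope (sub_nonneg.2 hxm)]

/-- Regret of coin betting for linear losses `-c t`, from a lower bound of Gaussian shape for the
final potential. -/
lemma IsBettingPotential.linear_regret_le {H : Type*} [NormedAddCommGroup H]
    [InnerProductSpace ℝ H] {F : ℕ → ℝ → ℝ} {ε : ℝ} (hF : IsBettingPotential F ε) {c : ℕ → H}
    (hc : ∀ t, ‖c t‖ ≤ 1) (T : ℕ) {a b : ℝ} (ha : 0 < a) (hb : 0 < b)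
    (hlow : ∀ x : ℝ, 0 ≤ x → x ≤ T → b * Real.exp (x ^ 2 / (2 * a)) ≤ F T x) (u : H) :
    ∑ t ∈ Finset.range T, ⟪c t, u - radialBet F (t + 1) (∑ s ∈ Finset.range t, c s)⟫ ≤
      ‖u‖ * √(a * Real.log (1 + a * ‖u‖ ^ 2 / b ^ 2)) + (ε - b) := by
  have h1 := hF.apply_norm_sum_le hc T
  have h2 := hlow _ (norm_nonneg _) (norm_sum_range_le_of_norm_le_one hc T)
  have h3 := mul_le_exp_sq_add (x := ‖∑ s ∈ Finset.range T, c s‖) ha hb (norm_nonneg u)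
  have h4 := real_inner_le_norm (∑ s ∈ Finset.range T, c s) u
  simp only [inner_sub_right, Finset.sum_sub_distrib, ← sum_inner]
  linarith

/-! ### The Krichevsky-Trofimov potential -/

/-- Gauss' product for `Γ(a + y) Γ(a - y)`.  It depends on `y` through `y²` only, and every factor
is a convex, increasing function of `y²`. -/
lemma tendsto_prod_Gamma_add_mul_Gamma_sub (a y : ℝ) :
    Filter.Tendsto (fun n : ℕ => ((n : ℝ) ^ a * n !) ^ 2 *
        ∏ j ∈ Finset.range (n + 1), ((a + j) ^ 2 - y ^ 2)⁻¹)
      Filter.atTop (nhds (Real.Gamma (a + y) * Real.Gamma (a - y))) := by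
  refine ((Real.GammaSeq_tendsto_Gamma (a + y)).mul
    (Real.GammaSeq_tendsto_Gamma (a - y))).congr' ?_
  filter_upwards [Filter.eventually_gt_atTop 0] with n hn
  have hn' : (0 : ℝ) < n := Nat.cast_pos.2 hn
  have hp : (n : ℝ) ^ (a + y) * (n : ℝ) ^ (a - y) = ((n : ℝ) ^ a) ^ 2 := by
    rw [← Real.rpow_add hn', sq, ← Real.rpow_add hn']; ring_nf
  have hq : ∏ j ∈ Finset.range (n + 1), ((a + j) ^ 2 - y ^ 2)⁻¹ =
      (∏ j ∈ Finset.range (n + 1), (a + y + j))⁻¹ *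
        (∏ j ∈ Finset.range (n + 1), (a - y + j))⁻¹ := by
    rw [Finset.prod_inv_distrib, ← mul_inv, ← Finset.prod_mul_distrib]
    congr 1
    exact Finset.prod_congr rfl fun j _ => by ring
  rw [hq, Real.GammaSeq, Real.GammaSeq, mul_pow, ← hp]
  ring

lemma sq_sub_pos_of_mem {a w : ℝ} (ha : 0 < a) (hw : w ∈ Set.Ico 0 ((2 * a) ^ 2)) (j : ℕ) :
    0 < (a + j) ^ 2 - w / 4 := by
  have : (0 : ℝ) ≤ j := Nat.cast_nonneg j
  nlinarith [hw.2]

lemma convexOn_prod_inv_sq_sub {a : ℝ} (ha : 0 < a) (n : ℕ) :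
    ConvexOn ℝ (Set.Ico 0 ((2 * a) ^ 2))
        (fun w : ℝ => ∏ j ∈ Finset.range n, ((a + j) ^ 2 - w / 4)⁻¹) ∧
      MonotoneOn (fun w : ℝ => ∏ j ∈ Finset.range n, ((a + j) ^ 2 - w / 4)⁻¹)
        (Set.Ico 0 ((2 * a) ^ 2)) := by
  have hmono : ∀ m : ℕ, MonotoneOn (fun w : ℝ => ((a + m) ^ 2 - w / 4)⁻¹)
      (Set.Ico 0 ((2 * a) ^ 2)) := fun m x _ y hy hxy =>
    inv_anti₀ (sq_sub_pos_of_mem ha hy m) (by linarith)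
  have hconv : ∀ m : ℕ, ConvexOn ℝ (Set.Ico 0 ((2 * a) ^ 2))
      (fun w : ℝ => ((a + m) ^ 2 - w / 4)⁻¹) := fun m => by
    refine ⟨convex_Ico _ _, fun x hx y hy s t hs ht hst => ?_⟩
    have h := (convexOn_zpow (-1) (𝕜 := ℝ)).2 (sq_sub_pos_of_mem ha hx m)
      (sq_sub_pos_of_mem ha hy m) hs ht hst
    have e : (a + (m : ℝ)) ^ 2 - (s * x + t * y) / 4 =
        s * ((a + (m : ℝ)) ^ 2 - x / 4) + t * ((a + (m : ℝ)) ^ 2 - y / 4) := by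
      linear_combination (-(a + (m : ℝ)) ^ 2) * hst
    simp only [smul_eq_mul, zpow_neg_one] at h ⊢
    rwa [e]
  have hmono' : ∀ m : ℕ, MonotoneOn
      (fun w : ℝ => ∏ j ∈ Finset.range m, ((a + j) ^ 2 - w / 4)⁻¹)
      (Set.Ico 0 ((2 * a) ^ 2)) := fun m x hx y hy hxy =>
    Finset.prod_le_prod (fun j _ => (inv_pos.2 (sq_sub_pos_of_mem ha hx j)).le)
      fun j _ => hmono j hx hy hxy
  refine ⟨?_, hmono' n⟩
  induction n with
  | zero => simpa using convexOn_const (1 : ℝ) (convex_Ico _ _)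
  | succ n ih =>
    simp only [Finset.prod_range_succ]
    exact ih.mul (hconv n)
      (fun w hw => Finset.prod_nonneg fun j _ => (inv_pos.2 (sq_sub_pos_of_mem ha hw j)).le)
      (fun w hw => (inv_pos.2 (sq_sub_pos_of_mem ha hw n)).le)
      ((hmono' n).monovaryOn (hmono n))

lemma tendsto_prod_Gamma_sqrt (a : ℝ) {w : ℝ} (hw : 0 ≤ w) :
    Filter.Tendsto (fun n : ℕ => ((n : ℝ) ^ a * n !) ^ 2 *
        ∏ j ∈ Finset.range (n + 1), ((a + j) ^ 2 - w / 4)⁻¹)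
      Filter.atTop (nhds (Real.Gamma (a + √w / 2) * Real.Gamma (a - √w / 2))) := by
  have h := tendsto_prod_Gamma_add_mul_Gamma_sub a (√w / 2)
  have e : (√w / 2) ^ 2 = w / 4 := by rw [div_pow, Real.sq_sqrt hw]; norm_num
  rwa [e] at h

lemma convexOn_Gamma_sqrt {a : ℝ} (ha : 0 < a) :
    ConvexOn ℝ (Set.Ico 0 ((2 * a) ^ 2))
      (fun w => Real.Gamma (a + √w / 2) * Real.Gamma (a - √w / 2)) := by
  refine ⟨convex_Ico _ _, fun x hx y hy s t hs ht hst => ?_⟩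
  have hxy := (convex_Ico (0 : ℝ) ((2 * a) ^ 2)) hx hy hs ht hst
  refine le_of_tendsto_of_tendsto' (tendsto_prod_Gamma_sqrt a hxy.1)
    (((tendsto_prod_Gamma_sqrt a hx.1).const_mul s).add
      ((tendsto_prod_Gamma_sqrt a hy.1).const_mul t)) fun n => ?_
  have h := (convexOn_prod_inv_sq_sub ha (n + 1)).1.2 hx hy hs ht hst
  simp only [smul_eq_mul] at h ⊢
  calc _ ≤ _ := mul_le_mul_of_nonneg_left h (sq_nonneg _)
    _ = _ := by ring

lemma monotoneOn_Gamma_sqrt {a : ℝ} (ha : 0 < a) :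
    MonotoneOn (fun w => Real.Gamma (a + √w / 2) * Real.Gamma (a - √w / 2))
      (Set.Ico 0 ((2 * a) ^ 2)) := fun _ hx _ hy hxy =>
  le_of_tendsto_of_tendsto' (tendsto_prod_Gamma_sqrt a hx.1) (tendsto_prod_Gamma_sqrt a hy.1)
    fun n => mul_le_mul_of_nonneg_left ((convexOn_prod_inv_sq_sub ha (n + 1)).2 hx hy hxy)
      (sq_nonneg _)

/-- The telescoping minorant `1 / (a + j) - 1 / (a + j + 1) ≤ 1 / (a + j)²` summed over the factors
of Gauss' product. -/
lemma prod_inv_sq_mul_exp_le {a y : ℝ} (ha : 0 < a) (hy : y ^ 2 < a ^ 2) (n : ℕ) :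
    (∏ j ∈ Finset.range n, ((a + j) ^ 2)⁻¹) * Real.exp (y ^ 2 * (1 / a - 1 / (a + n))) ≤
      ∏ j ∈ Finset.range n, ((a + j) ^ 2 - y ^ 2)⁻¹ := by
  induction n with
  | zero => simp
  | succ n ih =>
    have hn : (0 : ℝ) ≤ n := Nat.cast_nonneg n
    have hpos : 0 < (a + n) ^ 2 - y ^ 2 := by nlinarith
    have hA : 0 < (a + n) ^ 2 := by positivity
    have hstep : ((a + n) ^ 2)⁻¹ * Real.exp (y ^ 2 * (1 / (a + n) - 1 / (a + n + 1))) ≤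
        ((a + n) ^ 2 - y ^ 2)⁻¹ := by
      have h1 : y ^ 2 * (1 / (a + n) - 1 / (a + n + 1)) ≤ y ^ 2 / (a + n) ^ 2 := by
        rw [div_eq_mul_one_div (y ^ 2)]
        gcongr
        rw [div_sub_div _ _ (by positivity) (by positivity),
          div_le_div_iff₀ (by positivity) (by positivity)]
        nlinarith
      have h2 := Real.one_sub_le_exp_neg (y ^ 2 / (a + n) ^ 2)
      have h3 : ((a + n) ^ 2)⁻¹ * ((a + n) ^ 2 - y ^ 2) = 1 - y ^ 2 / (a + n) ^ 2 := by
        field_simp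
      rw [← one_div ((a + n) ^ 2 - y ^ 2), le_div_iff₀ hpos, mul_right_comm, h3]
      calc (1 - y ^ 2 / (a + n) ^ 2) * Real.exp (y ^ 2 * (1 / (a + n) - 1 / (a + n + 1)))
          ≤ Real.exp (-(y ^ 2 / (a + n) ^ 2)) * Real.exp (y ^ 2 / (a + n) ^ 2) := by gcongr
        _ = 1 := by rw [← Real.exp_add]; simp
    rw [Finset.prod_range_succ, Finset.prod_range_succ]
    have e : Real.exp (y ^ 2 * (1 / a - 1 / (a + ((n + 1 : ℕ) : ℝ)))) =
        Real.exp (y ^ 2 * (1 / a - 1 / (a + n))) *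
          Real.exp (y ^ 2 * (1 / (a + n) - 1 / (a + n + 1))) := by
      rw [← Real.exp_add]; push_cast; congr 1; rw [← add_assoc]; ring
    rw [e, mul_mul_mul_comm]
    exact mul_le_mul ih hstep (by positivity) (le_trans (mul_nonneg (Finset.prod_nonneg
      fun j _ => by positivity) (Real.exp_nonneg _)) ih)

lemma Gamma_sq_mul_exp_le {a y : ℝ} (ha : 0 < a) (hy : y ^ 2 < a ^ 2) :
    Real.Gamma a * Real.Gamma a * Real.exp (y ^ 2 / a) ≤
      Real.Gamma (a + y) * Real.Gamma (a - y) := by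
  have h0 := tendsto_prod_Gamma_add_mul_Gamma_sub a 0
  simp only [add_zero, sub_zero, ne_eq, OfNat.ofNat_ne_zero, not_false_eq_true, zero_pow] at h0
  have h1 : Filter.Tendsto (fun n : ℕ => Real.exp (y ^ 2 * (1 / a - 1 / (a + (n + 1 : ℕ)))))
      Filter.atTop (nhds (Real.exp (y ^ 2 / a))) := by
    have : Filter.Tendsto (fun n : ℕ => 1 / (a + ((n + 1 : ℕ) : ℝ))) Filter.atTop (nhds 0) := by
      simp only [one_div]
      exact Filter.Tendsto.inv_tendsto_atTop (Filter.tendsto_atTop_add_const_left _ _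
        (tendsto_natCast_atTop_atTop.comp (Filter.tendsto_add_atTop_nat 1)))
    have h := (Real.continuous_exp.tendsto _).comp ((this.const_sub (1 / a)).const_mul (y ^ 2))
    simpa [Function.comp_def, div_eq_mul_inv] using h
  refine le_of_tendsto_of_tendsto' (h0.mul h1) (tendsto_prod_Gamma_add_mul_Gamma_sub a y)
    fun n => ?_
  rw [mul_assoc]
  exact mul_le_mul_of_nonneg_left (prod_inv_sq_mul_exp_le ha hy (n + 1)) (sq_nonneg _)

lemma ktPotential_eq (ε : ℝ) (t : ℕ) (x : ℝ) :
    ktPotential ε t x = ε * 2 ^ t / (Real.pi * t !) *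
      (Real.Gamma (((t : ℝ) + 1) / 2 + x / 2) * Real.Gamma (((t : ℝ) + 1) / 2 - x / 2)) := by
  rw [ktPotential]; ring

lemma ktPotential_pos {ε : ℝ} (hε : 0 < ε) (t : ℕ) (x : ℝ) (hx : |x| < (t : ℝ) + 1) :
    0 < ktPotential ε t x := by
  have := abs_lt.1 hx
  have h1 : 0 < Real.Gamma (((t : ℝ) + 1) / 2 + x / 2) := Real.Gamma_pos_of_pos (by linarith)
  have h2 : 0 < Real.Gamma (((t : ℝ) + 1) / 2 - x / 2) := Real.Gamma_pos_of_pos (by linarith)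
  rw [ktPotential_eq]
  positivity

lemma ktPotential_succ_add_one (ε : ℝ) (t : ℕ) {x : ℝ} (hx : |x| < (t : ℝ) + 1) :
    ktPotential ε (t + 1) (x + 1) = (1 + x / (t + 1)) * ktPotential ε t x := by
  have := abs_lt.1 hx
  have e1 : (((t + 1 : ℕ) : ℝ) + 1) / 2 + (x + 1) / 2 = ((t : ℝ) + 1) / 2 + x / 2 + 1 := by
    push_cast; ring
  have e2 : (((t + 1 : ℕ) : ℝ) + 1) / 2 - (x + 1) / 2 = ((t : ℝ) + 1) / 2 - x / 2 := by
    push_cast; ring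
  rw [ktPotential_eq, ktPotential_eq, e1, e2, Real.Gamma_add_one (by linarith),
    Nat.factorial_succ]
  push_cast
  field_simp
  ring

lemma ktPotential_neg (ε : ℝ) (t : ℕ) (x : ℝ) : ktPotential ε t (-x) = ktPotential ε t x := by
  rw [ktPotential_eq, ktPotential_eq, neg_div, sub_neg_eq_add, ← sub_eq_add_neg,
    mul_comm (Real.Gamma (((t : ℝ) + 1) / 2 - x / 2))]

lemma ktPotential_succ_sub_one (ε : ℝ) (t : ℕ) {x : ℝ} (hx : |x| < (t : ℝ) + 1) :
    ktPotential ε (t + 1) (x - 1) = (1 - x / (t + 1)) * ktPotential ε t x := by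
  have h := ktPotential_succ_add_one ε t (x := -x) (by rwa [abs_neg])
  rw [ktPotential_neg, ← ktPotential_neg, neg_add, neg_neg, ← sub_eq_add_neg] at h
  rw [h, neg_div, ← sub_eq_add_neg]

lemma isBettingPotential_ktPotential {ε : ℝ} (hε : 0 < ε) :
    IsBettingPotential (ktPotential ε) ε where
  init := by
    rw [ktPotential_eq]
    simp only [CharP.cast_eq_zero, zero_add, zero_div, add_zero, sub_zero, pow_zero,
      Nat.factorial_zero, Nat.cast_one, mul_one, Real.Gamma_one_half_eq]
    rw [Real.mul_self_sqrt Real.pi_pos.le, div_mul_cancel₀ _ Real.pi_pos.ne']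
  even := ktPotential_neg ε
  pos := ktPotential_pos hε
  convexOn t := by
    have h := (convexOn_Gamma_sqrt (a := ((t : ℝ) + 1) / 2) (by positivity)).smul
      (show 0 ≤ ε * 2 ^ t / (Real.pi * t !) by positivity)
    rw [mul_div_cancel₀ _ (two_ne_zero)] at h
    simpa only [ktPotential_eq, smul_eq_mul] using h
  monotoneOn t := by
    have h := monotoneOn_Gamma_sqrt (a := ((t : ℝ) + 1) / 2) (by positivity)
    rw [mul_div_cancel₀ _ (two_ne_zero)] at h
    intro x hx y hy hxy
    simp only [ktPotential_eq]
    exact mul_le_mul_of_nonneg_left (h hx hy hxy) (by positivity)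
  step t x h0 hx := by
    have hx' : |x| < (t : ℝ) + 1 := by rw [abs_of_nonneg h0]; linarith
    rw [ktPotential_succ_add_one ε t hx', ktPotential_succ_sub_one ε t hx']
    linarith

/-- By the duplication formula, `F_T(0) F_{T+1}(0) = 2 ε² / (π (T + 1))`, and
`F_{T+1}(0) ≤ F_{T+1}(1) = F_T(0)`. -/
lemma ktPotential_zero_lower {ε : ℝ} (hε : 0 < ε) (T : ℕ) (hT : 0 < T) :
    ε / (Real.exp 1 * √(Real.pi * T)) ≤ ktPotential ε T 0 := by
  have hF := isBettingPotential_ktPotential hε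
  have hT1 : (1 : ℝ) ≤ T := by exact_mod_cast hT
  have hpos : 0 < ktPotential ε T 0 := ktPotential_pos hε T 0 (by rw [abs_zero]; linarith)
  have hle : ktPotential ε (T + 1) 0 ≤ ktPotential ε T 0 := by
    have h1 := hF.apply_mono (T + 1) le_rfl zero_le_one (by push_cast; linarith)
    have h2 := ktPotential_succ_add_one ε T (x := 0) (by rw [abs_zero]; linarith)
    rw [zero_add, zero_div, add_zero, one_mul] at h2
    rwa [h2] at h1
  have hmul : ktPotential ε T 0 * ktPotential ε (T + 1) 0 =
      2 * ε ^ 2 / (Real.pi * (T + 1)) := by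
    have hd := Real.Gamma_mul_Gamma_add_half (((T : ℝ) + 1) / 2)
    rw [mul_div_cancel₀ _ (two_ne_zero), Real.Gamma_nat_eq_factorial,
      show (1 : ℝ) - ((T : ℝ) + 1) = -(T : ℝ) by ring, Real.rpow_neg two_pos.le,
      Real.rpow_natCast] at hd
    have e : (((T + 1 : ℕ) : ℝ) + 1) / 2 = ((T : ℝ) + 1) / 2 + 1 / 2 := by push_cast; ring
    have hpi : √Real.pi ^ 2 = Real.pi := Real.sq_sqrt Real.pi_pos.le
    rw [ktPotential_eq, ktPotential_eq, zero_div, add_zero, sub_zero, add_zero, sub_zero, e,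
      Nat.factorial_succ]
    calc _ = ε ^ 2 * 2 ^ T * 2 ^ (T + 1) / (Real.pi * T ! * (Real.pi * ((T + 1) * T !))) *
          (Real.Gamma (((T : ℝ) + 1) / 2) * Real.Gamma (((T : ℝ) + 1) / 2 + 1 / 2)) ^ 2 := by
          push_cast; field_simp
      _ = _ := by
          rw [hd, mul_pow, mul_pow, hpi]
          field_simp
          ring
  have hexp : 1 ≤ Real.exp 1 := Real.one_le_exp zero_le_one
  refine le_of_sq_le_sq ?_ hpos.le
  calc (ε / (Real.exp 1 * √(Real.pi * T))) ^ 2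
      = ε ^ 2 / (Real.exp 1 ^ 2 * (Real.pi * T)) := by
        rw [div_pow, mul_pow, Real.sq_sqrt (by positivity)]
    _ ≤ ε ^ 2 / (1 ^ 2 * (Real.pi * T)) := by gcongr
    _ ≤ 2 * ε ^ 2 / (Real.pi * (T + 1)) := by
        rw [div_le_div_iff₀ (by positivity) (by positivity)]
        have : 0 < ε ^ 2 * Real.pi := by positivity
        nlinarith
    _ = ktPotential ε T 0 * ktPotential ε (T + 1) 0 := hmul.symm
    _ ≤ ktPotential ε T 0 ^ 2 := by rw [sq]; gcongr

lemma ktPotential_lower {ε : ℝ} (hε : 0 < ε) (T : ℕ) (hT : 0 < T) (x : ℝ) (hx0 : 0 ≤ x)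
    (hx : x ≤ T) :
    ε / (Real.exp 1 * √(Real.pi * T)) * Real.exp (x ^ 2 / (2 * (2 * ((T : ℝ) + 1)))) ≤
      ktPotential ε T x := by
  have ha : (0 : ℝ) < ((T : ℝ) + 1) / 2 := by positivity
  have h := Gamma_sq_mul_exp_le (y := x / 2) ha (by nlinarith)
  have h0 := ktPotential_zero_lower hε T hT
  have he : x ^ 2 / (2 * (2 * ((T : ℝ) + 1))) ≤ (x / 2) ^ 2 / (((T : ℝ) + 1) / 2) := by
    rw [div_le_div_iff₀ (by positivity) ha]
    have : 0 ≤ x ^ 2 * ((T : ℝ) + 1) := by positivity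
    nlinarith
  have hpos := ktPotential_pos hε T 0 (by rw [abs_zero]; positivity)
  calc _ ≤ ktPotential ε T 0 * Real.exp ((x / 2) ^ 2 / (((T : ℝ) + 1) / 2)) := by
        gcongr
    _ ≤ ktPotential ε T x := by
        rw [ktPotential_eq, ktPotential_eq, zero_div, add_zero, sub_zero, mul_assoc]
        gcongr

lemma coinBet_ktPotential {ε : ℝ} (hε : 0 < ε) (t : ℕ) {x : ℝ} (hx : |x| < (t : ℝ) + 1) :
    coinBet (ktPotential ε) (t + 1) x = x / (t + 1) * ktPotential ε t x := by
  have hpos := ktPotential_pos hε t x hx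
  rw [coinBet, betFraction, ktPotential_succ_add_one ε t hx, ktPotential_succ_sub_one ε t hx,
    Nat.add_sub_cancel]
  congr 1
  field_simp
  ring

lemma Gamma_add_three_quarters_le (t : ℕ) :
    Real.Gamma ((t : ℝ) + 3 / 4) ≤ t ! * Real.Gamma (3 / 4) := by
  induction t with
  | zero => simp
  | succ t ih =>
    have h0 : 0 < Real.Gamma ((t : ℝ) + 3 / 4) := Real.Gamma_pos_of_pos (by positivity)
    have e : ((t + 1 : ℕ) : ℝ) + 3 / 4 = (t : ℝ) + 3 / 4 + 1 := by push_cast; ring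
    rw [e, Real.Gamma_add_one (by positivity), Nat.factorial_succ]
    push_cast
    rw [mul_assoc]
    gcongr
    norm_num

/-- The point `t + 1/2` lies beyond the radius `t` of the states of round `t` and before the pole
at `t + 1`; the reflection formula evaluates `Γ(1/4) Γ(3/4)`. -/
lemma ktPotential_add_half_le {ε : ℝ} (hε : 0 < ε) (t : ℕ) :
    ktPotential ε t ((t : ℝ) + 1 / 2) ≤ √2 * ε * 2 ^ t := by
  have hr : Real.Gamma (3 / 4) * Real.Gamma (1 / 4) = Real.pi * √2 := by
    have h := Real.Gamma_mul_Gamma_one_sub (1 / 4)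
    rw [show (1 : ℝ) - 1 / 4 = 3 / 4 by norm_num, mul_one_div, Real.sin_pi_div_four] at h
    rw [mul_comm, h, div_div_eq_mul_div, div_eq_iff (by positivity), mul_assoc,
      Real.mul_self_sqrt two_pos.le]
  have hg : 0 < Real.Gamma (1 / 4) := Real.Gamma_pos_of_pos (by norm_num)
  rw [ktPotential_eq, show ((t : ℝ) + 1) / 2 + ((t : ℝ) + 1 / 2) / 2 = t + 3 / 4 by ring,
    show ((t : ℝ) + 1) / 2 - ((t : ℝ) + 1 / 2) / 2 = 1 / 4 by ring]
  calc _ ≤ ε * 2 ^ t / (Real.pi * t !) * (t ! * Real.Gamma (3 / 4) * Real.Gamma (1 / 4)) := by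
        gcongr
        exact Gamma_add_three_quarters_le t
    _ = ε * 2 ^ t / (Real.pi * t !) * (t ! * (Real.pi * √2)) := by rw [mul_assoc, hr]
    _ = √2 * ε * 2 ^ t := by field_simp

lemma coinBet_ktPotential_lipschitz {ε : ℝ} (hε : 0 < ε) (t : ℕ) (x y : ℝ) (hy : 0 ≤ y)
    (hyx : y ≤ x) (hx : x ≤ t) :
    |coinBet (ktPotential ε) (t + 1) x - coinBet (ktPotential ε) (t + 1) y| ≤
      3 * ε * 2 ^ t * (x - y) := by
  rcases hyx.eq_or_lt with rfl | hlt
  · simp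
  have hF := isBettingPotential_ktPotential hε
  have ht : (0 : ℝ) ≤ t := Nat.cast_nonneg t
  have hx0 : 0 ≤ x := hy.trans hyx
  rw [coinBet_ktPotential hε t (by rw [abs_of_nonneg hx0]; linarith),
    coinBet_ktPotential hε t (by rw [abs_of_nonneg hy]; linarith)]
  have hM := ktPotential_add_half_le hε t
  obtain ⟨M, hMdef⟩ : ∃ M, M = ktPotential ε t ((t : ℝ) + 1 / 2) := ⟨_, rfl⟩
  have hxM : ktPotential ε t x ≤ M := by
    rw [hMdef]; exact hF.apply_mono t hx0 (by linarith) (by linarith)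
  have hyx' : ktPotential ε t y ≤ ktPotential ε t x :=
    hF.apply_mono t hy hyx (by linarith)
  have hy0 : 0 < ktPotential ε t y := hF.pos t y (by rw [abs_of_nonneg hy]; linarith)
  -- by convexity in the square, the slope up to `x` is at most the slope from `x` to `t + 1/2`
  have hslope := (hF.convexOn t).slope_mono_adjacent (x := y ^ 2) (y := x ^ 2)
    (z := ((t : ℝ) + 1 / 2) ^ 2) ⟨sq_nonneg _, by nlinarith⟩ ⟨sq_nonneg _, by nlinarith⟩
    (by nlinarith) (by nlinarith)
  simp only [Real.sqrt_sq hx0, Real.sqrt_sq hy, Real.sqrt_sq (show 0 ≤ (t : ℝ) + 1 / 2 by linarith)]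
    at hslope
  rw [← hMdef] at hM hslope
  have hsq : 0 < x ^ 2 - y ^ 2 := by nlinarith
  have hsq' : 0 < ((t : ℝ) + 1 / 2) ^ 2 - x ^ 2 := by nlinarith
  have hdiff : ktPotential ε t x - ktPotential ε t y ≤ 2 * M * (x - y) := by
    rw [div_le_iff₀ hsq] at hslope
    refine hslope.trans ?_
    rw [div_mul_eq_mul_div, div_le_iff₀ hsq']
    have h1 : x ^ 2 - y ^ 2 ≤ 2 * (x - y) * (((t : ℝ) + 1 / 2) ^ 2 - x ^ 2) := by
      have : x + y ≤ 2 * (((t : ℝ) + 1 / 2) ^ 2 - x ^ 2) := by nlinarith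
      nlinarith
    have h2 : 0 ≤ x ^ 2 - y ^ 2 := hsq.le
    calc (M - ktPotential ε t x) * (x ^ 2 - y ^ 2) ≤ M * (x ^ 2 - y ^ 2) := by
          gcongr; linarith
      _ ≤ M * (2 * (x - y) * (((t : ℝ) + 1 / 2) ^ 2 - x ^ 2)) := by
          gcongr; linarith
      _ = _ := by ring
  have hnn : 0 ≤ x / (t + 1) * ktPotential ε t x - y / (t + 1) * ktPotential ε t y := by
    rw [sub_nonneg]; gcongr
  rw [abs_of_nonneg hnn]
  have hsqrt : √2 ≤ 3 / 2 := by
    rw [Real.sqrt_le_left (by norm_num)]; norm_num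
  have hε2 : 0 < ε * 2 ^ t := by positivity
  calc x / (t + 1) * ktPotential ε t x - y / (t + 1) * ktPotential ε t y
      = ((x - y) * ktPotential ε t x + y * (ktPotential ε t x - ktPotential ε t y)) / (t + 1) := by
        field_simp; ring
    _ ≤ ((x - y) * M + t * (2 * M * (x - y))) / (t + 1) := by
        gcongr
        linarith
    _ ≤ 2 * M * (x - y) := by
        rw [div_le_iff₀ (by positivity)]
        have : 0 ≤ M * (x - y) := mul_nonneg (by linarith) (by linarith)
        nlinarith
    _ ≤ 3 * ε * 2 ^ t * (x - y) := by
        have : M ≤ 3 / 2 * (ε * 2 ^ t) := hM.trans (by rw [mul_assoc]; gcongr)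
        exact mul_le_mul_of_nonneg_right (by linarith) (sub_nonneg.2 hyx)

/-! ### The shifted-exponential potential -/

lemma sePotential_pos {ε : ℝ} (hε : 0 < ε) (t : ℕ) (x : ℝ) : 0 < sePotential ε t x := by
  rw [sePotential]; positivity

lemma sePotential_succ_add_one (ε : ℝ) (t : ℕ) (x y : ℝ) (hy : y ^ 2 = 1) :
    sePotential ε (t + 1) (x + y) = ε / √((t : ℝ) + 2) *
      Real.exp ((x ^ 2 + 1) / (2 * ((t : ℝ) + 2))) * Real.exp (y * (x / ((t : ℝ) + 2))) := by
  rw [sePotential, mul_assoc, ← Real.exp_add]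
  have e : ((t + 1 : ℕ) : ℝ) + 1 = (t : ℝ) + 2 := by push_cast; ring
  rw [e]
  congr 2
  rw [add_sq, hy]
  field_simp
  ring

lemma isBettingPotential_sePotential {ε : ℝ} (hε : 0 < ε) :
    IsBettingPotential (sePotential ε) ε where
  init := by simp [sePotential]
  even t x := by simp [sePotential]
  pos t x _ := sePotential_pos hε t x
  convexOn t := by
    refine ⟨convex_Ico _ _, fun x hx y hy a b ha hb hab => ?_⟩
    have hxy := (convex_Ico (0 : ℝ) (((t : ℝ) + 1) ^ 2)) hx hy ha hb hab
    have h := convexOn_exp.2 (Set.mem_univ (x / (2 * ((t : ℝ) + 1))))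
      (Set.mem_univ (y / (2 * ((t : ℝ) + 1)))) ha hb hab
    simp only [smul_eq_mul, sePotential] at h hxy ⊢
    rw [Real.sq_sqrt hx.1, Real.sq_sqrt hy.1, Real.sq_sqrt hxy.1]
    have e : (a * x + b * y) / (2 * ((t : ℝ) + 1)) =
      a * (x / (2 * ((t : ℝ) + 1))) + b * (y / (2 * ((t : ℝ) + 1))) := by ring
    rw [e]
    have hc : 0 ≤ ε / √((t : ℝ) + 1) := by positivity
    linarith [mul_le_mul_of_nonneg_left h hc]
  monotoneOn t x hx y hy hxy := by
    simp only [sePotential]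
    rw [Real.sq_sqrt hx.1, Real.sq_sqrt hy.1]
    gcongr
  step t x _ _ := by
    have ht : (0 : ℝ) ≤ t := Nat.cast_nonneg t
    have h1 := sePotential_succ_add_one ε t x 1 (by norm_num)
    have h2 := sePotential_succ_add_one ε t x (-1) (by norm_num)
    rw [← sub_eq_add_neg] at h2
    rw [h1, h2, one_mul, neg_one_mul, ← mul_add]
    have hcosh : Real.exp (x / ((t : ℝ) + 2)) + Real.exp (-(x / ((t : ℝ) + 2))) ≤
        2 * Real.exp ((x / ((t : ℝ) + 2)) ^ 2 / 2) := by
      have := Real.cosh_le_exp_half_sq (x / ((t : ℝ) + 2))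
      rw [Real.cosh_eq] at this
      linarith
    -- `log (1 + 1 / (t + 1)) ≥ 1 / (t + 2)` pays for the constant term of the exponent
    have hsqrt : Real.exp (1 / (2 * ((t : ℝ) + 2))) / √((t : ℝ) + 2) ≤ 1 / √((t : ℝ) + 1) := by
      rw [div_le_div_iff₀ (by positivity) (by positivity), one_mul]
      refine Real.le_sqrt_of_sq_le ?_
      rw [mul_pow, Real.sq_sqrt (by positivity), ← Real.exp_nat_mul]
      have e : ((2 : ℕ) : ℝ) * (1 / (2 * ((t : ℝ) + 2))) = 1 / ((t : ℝ) + 2) := by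
        push_cast; field_simp
      have h := Real.one_sub_le_exp_neg (1 / ((t : ℝ) + 2))
      have h' : 1 - 1 / ((t : ℝ) + 2) = ((t : ℝ) + 1) / (t + 2) := by field_simp; ring
      rw [h', div_le_iff₀ (by positivity), Real.exp_neg] at h
      rw [e, mul_comm]
      have hE := Real.exp_pos (1 / ((t : ℝ) + 2))
      calc ((t : ℝ) + 1) * Real.exp (1 / ((t : ℝ) + 2))
          ≤ (Real.exp (1 / ((t : ℝ) + 2)))⁻¹ * (t + 2) * Real.exp (1 / ((t : ℝ) + 2)) := by gcongr
        _ = t + 2 := by field_simp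
    have hexp : x ^ 2 / (2 * ((t : ℝ) + 2)) + (x / ((t : ℝ) + 2)) ^ 2 / 2 ≤
        x ^ 2 / (2 * ((t : ℝ) + 1)) := by
      have : x ^ 2 / (2 * ((t : ℝ) + 2)) + (x / ((t : ℝ) + 2)) ^ 2 / 2 =
          x ^ 2 * (t + 3) / (2 * ((t : ℝ) + 2) ^ 2) := by field_simp; ring
      rw [this, div_le_div_iff₀ (by positivity) (by positivity)]
      have := sq_nonneg x
      nlinarith
    rw [sePotential, add_div, Real.exp_add]
    calc _ ≤ ε / √((t : ℝ) + 2) *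
          (Real.exp (x ^ 2 / (2 * ((t : ℝ) + 2))) * Real.exp (1 / (2 * ((t : ℝ) + 2)))) *
          (2 * Real.exp ((x / ((t : ℝ) + 2)) ^ 2 / 2)) := by gcongr
      _ = 2 * (ε * (Real.exp (1 / (2 * ((t : ℝ) + 2))) / √((t : ℝ) + 2)) *
          Real.exp (x ^ 2 / (2 * ((t : ℝ) + 2)) + (x / ((t : ℝ) + 2)) ^ 2 / 2)) := by
          rw [Real.exp_add]; ring
      _ ≤ 2 * (ε * (1 / √((t : ℝ) + 1)) * Real.exp (x ^ 2 / (2 * ((t : ℝ) + 1)))) := by gcongr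
      _ = _ := by ring

lemma betFraction_sePotential {ε : ℝ} (hε : 0 < ε) (t : ℕ) (x : ℝ) :
    betFraction (sePotential ε) (t + 1) x = Real.tanh (x / ((t : ℝ) + 2)) := by
  have h1 := sePotential_succ_add_one ε t x 1 (by norm_num)
  have h2 := sePotential_succ_add_one ε t x (-1) (by norm_num)
  rw [← sub_eq_add_neg] at h2
  have hpos : 0 < ε / √((t : ℝ) + 2) * Real.exp ((x ^ 2 + 1) / (2 * ((t : ℝ) + 2))) := by
    positivity
  rw [betFraction, h1, h2, one_mul, neg_one_mul, ← mul_sub, ← mul_add,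
    mul_div_mul_left _ _ hpos.ne', Real.tanh_eq]

lemma sinh_le_mul_cosh {z : ℝ} (hz : 0 ≤ z) : Real.sinh z ≤ z * Real.cosh z := by
  have hd : ∀ x : ℝ, HasDerivAt (fun x => x * Real.cosh x - Real.sinh x)
      (1 * Real.cosh x + x * Real.sinh x - Real.cosh x) x := fun x =>
    ((hasDerivAt_id x).mul (Real.hasDerivAt_cosh x)).sub (Real.hasDerivAt_sinh x)
  have hmono : MonotoneOn (fun x => x * Real.cosh x - Real.sinh x) (Set.Ici 0) := by
    refine monotoneOn_of_deriv_nonneg (convex_Ici 0)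
      (fun x _ => (hd x).continuousAt.continuousWithinAt)
      (fun x _ => (hd x).differentiableAt.differentiableWithinAt) fun x hx => ?_
    rw [interior_Ici] at hx
    rw [(hd x).deriv, one_mul, add_sub_cancel_left]
    exact mul_nonneg hx.le (Real.sinh_nonneg_iff.2 hx.le)
  have h := hmono Set.self_mem_Ici hz hz
  simp only [Real.cosh_zero, Real.sinh_zero, mul_one, sub_zero] at h
  linarith

lemma tanh_sub_tanh_mem_Icc {x y : ℝ} (hy : 0 ≤ y) (hyx : y ≤ x) :
    Real.tanh x - Real.tanh y ∈ Set.Icc 0 (x - y) := by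
  have hz : 0 ≤ x - y := sub_nonneg.2 hyx
  have hx : 0 < Real.cosh x := Real.cosh_pos x
  have hy' : 1 ≤ Real.cosh y := Real.one_le_cosh y
  have e : Real.tanh x - Real.tanh y = Real.sinh (x - y) / (Real.cosh x * Real.cosh y) := by
    rw [Real.tanh_eq_sinh_div_cosh, Real.tanh_eq_sinh_div_cosh, Real.sinh_sub,
      div_sub_div _ _ hx.ne' (by linarith)]
  have hc : Real.cosh (x - y) ≤ Real.cosh x := by
    rw [Real.cosh_le_cosh, abs_of_nonneg hz, abs_of_nonneg (hy.trans hyx)]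
    linarith
  rw [e]
  refine ⟨div_nonneg (Real.sinh_nonneg_iff.2 hz) (by positivity), ?_⟩
  rw [div_le_iff₀ (by positivity)]
  calc _ ≤ _ := sinh_le_mul_cosh hz
    _ ≤ (x - y) * (Real.cosh x * 1) := by rw [mul_one]; gcongr
    _ ≤ _ := by gcongr

lemma coinBet_sePotential_lipschitz {ε : ℝ} (hε : 0 < ε) (t : ℕ) (x y : ℝ) (hy : 0 ≤ y)
    (hyx : y ≤ x) (hx : x ≤ t) :
    |coinBet (sePotential ε) (t + 1) x - coinBet (sePotential ε) (t + 1) y| ≤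
      ε * Real.exp (t / 2) * (x - y) := by
  have ht : (0 : ℝ) ≤ t := Nat.cast_nonneg t
  have hx0 : 0 ≤ x := hy.trans hyx
  have hd : 0 ≤ x - y := sub_nonneg.2 hyx
  simp only [coinBet, betFraction_sePotential hε, Nat.add_sub_cancel]
  obtain ⟨v, hv⟩ : ∃ v, v = x / ((t : ℝ) + 2) := ⟨_, rfl⟩
  obtain ⟨w, hw⟩ : ∃ w, w = y / ((t : ℝ) + 2) := ⟨_, rfl⟩
  rw [← hv, ← hw]
  have hw0 : 0 ≤ w := by rw [hw]; positivity
  have hwv : w ≤ v := by rw [hw, hv]; gcongr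
  have htanh := (tanh_sub_tanh_mem_Icc hw0 hwv).2
  have hmono : Real.tanh w ≤ Real.tanh v := sub_nonneg.1 (tanh_sub_tanh_mem_Icc hw0 hwv).1
  have htw : 0 ≤ Real.tanh w := by
    simpa using (tanh_sub_tanh_mem_Icc le_rfl hw0).1
  have htv : Real.tanh v ≤ 1 := (Real.tanh_lt_one v).le
  have hFx0 := sePotential_pos hε t x
  have hFy0 := sePotential_pos hε t y
  have hFy : sePotential ε t y ≤ sePotential ε t x := by
    simp only [sePotential]; gcongr
  have hFx : sePotential ε t x ≤ ε * Real.exp (t / 2) := by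
    have hexp : x ^ 2 / (2 * ((t : ℝ) + 1)) ≤ t / 2 := by
      rw [div_le_div_iff₀ (by positivity) (by positivity)]
      nlinarith
    rw [sePotential]
    gcongr
    exact div_le_self hε.le (Real.one_le_sqrt.2 (by linarith))
  have hF : sePotential ε t x - sePotential ε t y ≤
      sePotential ε t x * (t / (t + 1) * (x - y)) := by
    have h := Real.one_sub_le_exp_neg ((x ^ 2 - y ^ 2) / (2 * ((t : ℝ) + 1)))
    have e : sePotential ε t y = sePotential ε t x *
        Real.exp (-((x ^ 2 - y ^ 2) / (2 * ((t : ℝ) + 1)))) := by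
      rw [sePotential, sePotential, mul_assoc, ← Real.exp_add]; ring_nf
    have h2 : (x ^ 2 - y ^ 2) / (2 * ((t : ℝ) + 1)) ≤ t / (t + 1) * (x - y) := by
      rw [div_mul_eq_mul_div, div_le_div_iff₀ (by positivity) (by positivity)]
      have : x ^ 2 - y ^ 2 ≤ 2 * t * (x - y) := by nlinarith
      nlinarith
    rw [e]
    nlinarith
  have hnn : 0 ≤ Real.tanh v * sePotential ε t x - Real.tanh w * sePotential ε t y := by
    rw [sub_nonneg]; gcongr; exact htw.trans hmono
  have hvw : v - w = (x - y) / (t + 2) := by rw [hv, hw]; ring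
  rw [abs_of_nonneg hnn]
  calc Real.tanh v * sePotential ε t x - Real.tanh w * sePotential ε t y
      = Real.tanh v * (sePotential ε t x - sePotential ε t y) +
        (Real.tanh v - Real.tanh w) * sePotential ε t y := by ring
    _ ≤ 1 * (sePotential ε t x * (t / (t + 1) * (x - y))) +
        (x - y) / (t + 2) * sePotential ε t x := by
        rw [← hvw]
        gcongr
    _ = sePotential ε t x * ((t / (t + 1) + 1 / (t + 2)) * (x - y)) := by ring
    _ ≤ sePotential ε t x * (1 * (x - y)) := by
        gcongr
        rw [div_add_div _ _ (by positivity) (by positivity), div_le_one (by positivity)]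
        nlinarith
    _ ≤ ε * Real.exp (t / 2) * (x - y) := by rw [one_mul]; gcongr

/-! ### Averaging by a gossip matrix -/

section Mixing

variable {N : ℕ}

lemma norm_toLp_le_of_sum_sq_le {E : Type*} [SeminormedAddCommGroup E]
    {z w : Fin N → E} {c : ℝ}
    (hc : 0 ≤ c)
    (h : ∑ n, ‖z n‖ ^ 2 ≤ c ^ 2 * ∑ n, ‖w n‖ ^ 2) :
    ‖WithLp.toLp 2 z‖ ≤ c * ‖WithLp.toLp 2 w‖ := by
  refine le_of_sq_le_sq ?_ (by positivity)
  rwa [mul_pow, PiLp.norm_sq_eq_of_L2, PiLp.norm_sq_eq_of_L2]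

lemma norm_toLp_le_sqrt_mul {E : Type*} [SeminormedAddCommGroup E] {z : Fin N → E} {c : ℝ}
    (hc : 0 ≤ c) (h : ∀ n, ‖z n‖ ≤ c) :
    ‖WithLp.toLp 2 z‖ ≤ √N * c := by
  refine le_of_sq_le_sq ?_ (by positivity)
  rw [mul_pow, Real.sq_sqrt (Nat.cast_nonneg N), PiLp.norm_sq_eq_of_L2]
  calc ∑ n, ‖z n‖ ^ 2 ≤ ∑ _n : Fin N, c ^ 2 := by
        gcongr with n; exact h n
    _ = N * c ^ 2 := by simp

variable {H : Type*} [NormedAddCommGroup H] [InnerProductSpace ℝ H]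

/-- The action of a matrix on families of vectors. -/
noncomputable def mix (W : Matrix (Fin N) (Fin N) ℝ) (z : Fin N → H) : Fin N → H :=
  fun n => ∑ j, W n j • z j

/-- The average of the agents' vectors. -/
noncomputable def agentMean (z : Fin N → H) : H := (1 / (N : ℝ)) • ∑ n, z n

/-- The stacked deviations of the agents from their average. -/
noncomputable def disagreement (z : Fin N → H) : PiLp 2 (fun _ : Fin N => H) :=
  WithLp.toLp 2 fun n => z n - agentMean z

lemma norm_agentMean_le (hN : 0 < N) {z : Fin N → H} (hz : ∀ n, ‖z n‖ ≤ 1) :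
    ‖agentMean z‖ ≤ 1 := by
  have hN' : (0 : ℝ) < N := Nat.cast_pos.2 hN
  rw [agentMean, norm_smul, Real.norm_of_nonneg (by positivity), one_div,
    inv_mul_le_iff₀ hN', mul_one]
  simpa using norm_sum_le_of_le Finset.univ fun n _ => hz n

lemma norm_sub_agentMean_le (z : Fin N → H) (n : Fin N) :
    ‖z n - agentMean z‖ ≤ ‖disagreement z‖ :=
  PiLp.norm_apply_le (disagreement z) n

lemma IsGossipMatrix.sum_row {𝒢 : SimpleGraph (Fin N)} {W : Matrix (Fin N) (Fin N) ℝ}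
    (hW : IsGossipMatrix 𝒢 W) (n : Fin N) : ∑ j, W n j = 1 :=
  sum_row_of_mem_doublyStochastic hW.doublyStoch n

lemma IsGossipMatrix.sum_col {𝒢 : SimpleGraph (Fin N)} {W : Matrix (Fin N) (Fin N) ℝ}
    (hW : IsGossipMatrix 𝒢 W) (j : Fin N) : ∑ n, W n j = 1 :=
  sum_col_of_mem_doublyStochastic hW.doublyStoch j

lemma IsGossipMatrix.entry_nonneg {𝒢 : SimpleGraph (Fin N)} {W : Matrix (Fin N) (Fin N) ℝ}
    (hW : IsGossipMatrix 𝒢 W) (n j : Fin N) : 0 ≤ W n j :=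
  nonneg_of_mem_doublyStochastic hW.doublyStoch

/-- The variance identity for the row weights of a gossip matrix, summed over the rows. -/
lemma IsGossipMatrix.sum_sq_sub_sum_mix_sq {𝒢 : SimpleGraph (Fin N)}
    {W : Matrix (Fin N) (Fin N) ℝ} (hW : IsGossipMatrix 𝒢 W) (z : Fin N → H) :
    ∑ n, ‖z n‖ ^ 2 - ∑ n, ‖mix W z n‖ ^ 2 = ∑ n, ∑ j, W n j * ‖z j - mix W z n‖ ^ 2 := by
  have hrow : ∀ n, ∑ j, W n j * ‖z j - mix W z n‖ ^ 2 =
      ∑ j, W n j * ‖z j‖ ^ 2 - ‖mix W z n‖ ^ 2 := fun n => by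
    have h1 : ∑ j, W n j * ⟪z j, mix W z n⟫ = ‖mix W z n‖ ^ 2 := by
      rw [← real_inner_self_eq_norm_sq]
      conv_rhs => rw [mix, sum_inner]
      simp only [real_inner_smul_left]
      rfl
    calc ∑ j, W n j * ‖z j - mix W z n‖ ^ 2
        = ∑ j, (W n j * ‖z j‖ ^ 2 - 2 * (W n j * ⟪z j, mix W z n⟫) +
            W n j * ‖mix W z n‖ ^ 2) := by
          refine Finset.sum_congr rfl fun j _ => ?_
          rw [norm_sub_sq_real]; ring
      _ = _ := by
          rw [Finset.sum_add_distrib, Finset.sum_sub_distrib, ← Finset.mul_sum, h1,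
            ← Finset.sum_mul, hW.sum_row]
          ring
  simp only [hrow, Finset.sum_sub_distrib]
  rw [Finset.sum_comm]
  simp only [← Finset.sum_mul, hW.sum_col, one_mul]

lemma IsGossipMatrix.norm_mix_le {𝒢 : SimpleGraph (Fin N)} {W : Matrix (Fin N) (Fin N) ℝ}
    (hW : IsGossipMatrix 𝒢 W) (z : Fin N → H) :
    ‖WithLp.toLp 2 (mix W z)‖ ≤ ‖WithLp.toLp 2 z‖ := by
  have h := hW.sum_sq_sub_sum_mix_sq z
  have h0 : 0 ≤ ∑ n, ∑ j, W n j * ‖z j - mix W z n‖ ^ 2 :=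
    Finset.sum_nonneg fun n _ => Finset.sum_nonneg fun j _ =>
      mul_nonneg (hW.entry_nonneg n j) (sq_nonneg _)
  simpa using norm_toLp_le_of_sum_sq_le (z := mix W z) (w := z) zero_le_one (by linarith)

lemma IsGossipMatrix.norm_mix_sub_le {𝒢 : SimpleGraph (Fin N)} {W : Matrix (Fin N) (Fin N) ℝ}
    (hW : IsGossipMatrix 𝒢 W) (z : Fin N → H) :
    ‖WithLp.toLp 2 (mix W z) - WithLp.toLp 2 z‖ ≤ 2 * ‖WithLp.toLp 2 z‖ := by
  linarith [norm_sub_le (WithLp.toLp 2 (mix W z)) (WithLp.toLp 2 z), hW.norm_mix_le z]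

/-- The contraction factor, defined by real vectors, applies to vectors in `H`: expand in an
orthonormal basis of the span of the agents' vectors. -/
lemma IsContractionFactor.norm_mix_le {W : Matrix (Fin N) (Fin N) ℝ} {ρ : ℝ}
    (hρ : IsContractionFactor W ρ) (z : Fin N → H) (hz : ∑ n, z n = 0) :
    ‖WithLp.toLp 2 (mix W z)‖ ≤ ρ * ‖WithLp.toLp 2 z‖ := by
  refine norm_toLp_le_of_sum_sq_le hρ.nonneg ?_
  have hfin : FiniteDimensional ℝ (Submodule.span ℝ (Set.range z)) :=
    FiniteDimensional.span_of_finite ℝ (Set.finite_range z)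
  let b := stdOrthonormalBasis ℝ (Submodule.span ℝ (Set.range z))
  have hmem : ∀ n, z n ∈ Submodule.span ℝ (Set.range z) := fun n =>
    Submodule.subset_span (Set.mem_range_self n)
  have hmix : ∀ n, mix W z n ∈ Submodule.span ℝ (Set.range z) := fun n =>
    Submodule.sum_mem _ fun j _ => Submodule.smul_mem _ _ (hmem j)
  have hexp : ∀ v ∈ Submodule.span ℝ (Set.range z), ‖v‖ ^ 2 = ∑ i, ⟪(b i : H), v⟫ ^ 2 :=
    fun v hv => by
      have h := b.sum_sq_norm_inner_right ⟨v, hv⟩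
      simp only [Submodule.coe_inner, Real.norm_eq_abs, sq_abs] at h
      rw [h]; rfl
  have hsc : ∀ i, ∑ n, ⟪(b i : H), mix W z n⟫ ^ 2 ≤ ρ ^ 2 * ∑ n, ⟪(b i : H), z n⟫ ^ 2 :=
    fun i => by
      have h := hρ.contracts (fun n => ⟪(b i : H), z n⟫) (by rw [← inner_sum, hz, inner_zero_right])
      have h2 := pow_le_pow_left₀ (Real.sqrt_nonneg _) h 2
      rw [mul_pow, Real.sq_sqrt (Finset.sum_nonneg fun _ _ => sq_nonneg _),
        Real.sq_sqrt (Finset.sum_nonneg fun _ _ => sq_nonneg _)] at h2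
      simpa only [mix, inner_sum, real_inner_smul_right] using h2
  calc ∑ n, ‖mix W z n‖ ^ 2 = ∑ i, ∑ n, ⟪(b i : H), mix W z n⟫ ^ 2 := by
        rw [Finset.sum_comm]
        exact Finset.sum_congr rfl fun n _ => hexp _ (hmix n)
    _ ≤ ∑ i, ρ ^ 2 * ∑ n, ⟪(b i : H), z n⟫ ^ 2 := Finset.sum_le_sum fun i _ => hsc i
    _ = ρ ^ 2 * ∑ n, ‖z n‖ ^ 2 := by
        rw [← Finset.mul_sum, Finset.sum_comm]
        congr 1
        exact Finset.sum_congr rfl fun n _ => (hexp _ (hmem n)).symm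

/-- Equality in Jensen's inequality forces neighbouring agents to agree, because self-weights and
edge weights are positive. -/
lemma IsGossipMatrix.eq_of_norm_mix_eq {𝒢 : SimpleGraph (Fin N)} (h𝒢 : 𝒢.Connected)
    {W : Matrix (Fin N) (Fin N) ℝ} (hW : IsGossipMatrix 𝒢 W) {z : Fin N → H}
    (h : ∑ n, ‖z n‖ ^ 2 ≤ ∑ n, ‖mix W z n‖ ^ 2) (m n : Fin N) : z m = z n := by
  have hnn : ∀ n j, 0 ≤ W n j * ‖z j - mix W z n‖ ^ 2 := fun n j =>
    mul_nonneg (hW.entry_nonneg n j) (sq_nonneg _)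
  have hle : ∑ n, ∑ j, W n j * ‖z j - mix W z n‖ ^ 2 ≤ 0 := by
    rw [← hW.sum_sq_sub_sum_mix_sq z]; linarith
  have hzero : ∀ n j, 0 < W n j → z j = mix W z n := fun n j hpos => by
    have h1 : W n j * ‖z j - mix W z n‖ ^ 2 ≤ 0 := calc
      _ ≤ ∑ j, W n j * ‖z j - mix W z n‖ ^ 2 :=
        Finset.single_le_sum (f := fun j => W n j * ‖z j - mix W z n‖ ^ 2)
          (fun j _ => hnn n j) (Finset.mem_univ j)
      _ ≤ ∑ n, ∑ j, W n j * ‖z j - mix W z n‖ ^ 2 :=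
        Finset.single_le_sum (f := fun n => ∑ j, W n j * ‖z j - mix W z n‖ ^ 2)
          (fun n _ => Finset.sum_nonneg fun j _ => hnn n j) (Finset.mem_univ n)
      _ ≤ 0 := hle
    have h2 : ‖z j - mix W z n‖ ^ 2 = 0 := by
      have := sq_nonneg ‖z j - mix W z n‖
      nlinarith
    simpa [sub_eq_zero] using h2
  have hadj : ∀ a b, 𝒢.Adj a b → z a = z b := fun a b hab => by
    rw [hzero a b (hW.pos_of_adj a b hab), hzero a a (hW.self_pos a)]
  obtain ⟨p⟩ := h𝒢.preconnected m n
  induction p with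
  | nil => rfl
  | cons hab _ ih => exact (hadj _ _ hab).trans ih

/-- Compactness of the unit sphere of the zero-mean vectors turns strict contraction into a
contraction factor. -/
lemma IsGossipMatrix.exists_isContractionFactor {𝒢 : SimpleGraph (Fin N)} (h𝒢 : 𝒢.Connected)
    {W : Matrix (Fin N) (Fin N) ℝ} (hW : IsGossipMatrix 𝒢 W) :
    ∃ ρ : ℝ, IsContractionFactor W ρ := by
  let K : Set (Fin N → ℝ) := {z | ∑ n, z n = 0 ∧ ∑ n, z n ^ 2 = 1}
  let f : (Fin N → ℝ) → ℝ := fun z => √(∑ n, (∑ j, W n j * z j) ^ 2)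
  have hf : Continuous f := by fun_prop
  have hK : IsCompact K := by
    refine Metric.isCompact_of_isClosed_isBounded ?_ ?_
    · exact (isClosed_eq (by fun_prop) (by fun_prop)).inter
        (isClosed_eq (by fun_prop) (by fun_prop))
    · refine (Metric.isBounded_closedBall (x := (0 : Fin N → ℝ)) (r := 1)).subset fun z hz => ?_
      rw [mem_closedBall_zero_iff, pi_norm_le_iff_of_nonneg zero_le_one]
      intro n
      rw [Real.norm_eq_abs, ← sq_le_one_iff_abs_le_one, ← hz.2]
      exact Finset.single_le_sum (f := fun n => z n ^ 2) (fun _ _ => sq_nonneg _)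
        (Finset.mem_univ n)
  have hlt : ∀ z ∈ K, f z < 1 := fun z hz => by
    rw [Real.sqrt_lt' one_pos, one_pow]
    by_contra! hcon
    have hconst := hW.eq_of_norm_mix_eq h𝒢 (z := z) (by
      simpa only [Real.norm_eq_abs, sq_abs, hz.2, mix, smul_eq_mul] using hcon)
    have hz0 : ∀ n, z n = 0 := fun n => by
      have h1 : ∑ m, z m = N * z n := by
        rw [Finset.sum_congr rfl fun m _ => hconst m n]; simp
      have hN : (N : ℝ) ≠ 0 := Nat.cast_ne_zero.2 (Fin.pos n).ne'
      rw [hz.1] at h1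
      simpa [hN] using h1.symm
    have h2 := hz.2
    simp [hz0] at h2
  obtain ⟨ρ, hρ0, hρ1, hρ⟩ : ∃ ρ, 0 ≤ ρ ∧ ρ < 1 ∧ ∀ z ∈ K, f z ≤ ρ := by
    rcases K.eq_empty_or_nonempty with hE | hne
    · exact ⟨0, le_rfl, one_pos, fun z hz => by simp [hE] at hz⟩
    · obtain ⟨z, hz, hmax⟩ := hK.exists_isMaxOn hne hf.continuousOn
      exact ⟨f z, Real.sqrt_nonneg _, hlt z hz, fun w hw => hmax hw⟩
  refine ⟨ρ, hρ0, hρ1, fun z hz => ?_⟩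
  obtain ⟨s, hs⟩ : ∃ s, s = √(∑ n, z n ^ 2) := ⟨_, rfl⟩
  have hsum0 : 0 ≤ ∑ n, z n ^ 2 := Finset.sum_nonneg fun _ _ => sq_nonneg _
  have hs0 : 0 ≤ s := by rw [hs]; positivity
  have hs2 : s ^ 2 = ∑ n, z n ^ 2 := by rw [hs, Real.sq_sqrt hsum0]
  rw [← hs]
  rcases hs0.eq_or_lt with h0 | hpos
  · rw [← h0, mul_zero]
    rw [← h0, zero_pow two_ne_zero, eq_comm,
      Finset.sum_eq_zero_iff_of_nonneg fun _ _ => sq_nonneg _] at hs2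
    have : ∀ n, z n = 0 := fun n => by simpa using hs2 n (Finset.mem_univ n)
    simp [this]
  · have hmem : (fun n => z n / s) ∈ K :=
      ⟨by rw [← Finset.sum_div, hz, zero_div], by
        simp only [div_pow]
        rw [← Finset.sum_div, ← hs2, div_self (by positivity)]⟩
    have h := hρ _ hmem
    have e : f (fun n => z n / s) = √(∑ n, (∑ j, W n j * z j) ^ 2) / s := by
      simp only [f, ← mul_div_assoc, ← Finset.sum_div, div_pow]
      rw [Real.sqrt_div' _ (sq_nonneg _), Real.sqrt_sq hs0]
    rwa [e, div_le_iff₀ hpos] at h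

/-! ### One compressed gossip substep -/

lemma sum_sub_agentMean (hN : 0 < N) (z : Fin N → H) : ∑ n, (z n - agentMean z) = 0 := by
  have hN' : (N : ℝ) ≠ 0 := Nat.cast_ne_zero.2 hN.ne'
  rw [Finset.sum_sub_distrib, Finset.sum_const, Finset.card_univ, Fintype.card_fin, agentMean,
    ← Nat.cast_smul_eq_nsmul ℝ, smul_smul, mul_one_div_cancel hN', one_smul, sub_self]

lemma IsGossipMatrix.sum_smul_sub {𝒢 : SimpleGraph (Fin N)} {W : Matrix (Fin N) (Fin N) ℝ}
    (hW : IsGossipMatrix 𝒢 W) (y : Fin N → H) (n : Fin N) :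
    ∑ j, W n j • (y j - y n) = mix W y n - y n := by
  simp only [smul_sub, Finset.sum_sub_distrib, ← Finset.sum_smul, hW.sum_row, one_smul, mix]

variable {Ξ : Type*} {𝒢 : SimpleGraph (Fin N)} {W : Matrix (Fin N) (Fin N) ℝ}

lemma IsGossipMatrix.sum_gossipSubstep (hW : IsGossipMatrix 𝒢 W) (γ : ℝ) (C : Ξ → H → H)
    (s : Fin N → Ξ) (p : (Fin N → H) × (Fin N → H)) :
    ∑ n, (gossipSubstep W γ C s p).1 n = ∑ n, p.1 n := by
  have h : ∀ y : Fin N → H, ∑ n, (mix W y n - y n) = 0 := fun y => by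
    simp only [mix]
    rw [Finset.sum_sub_distrib, Finset.sum_comm]
    simp only [← Finset.sum_smul, hW.sum_col, one_smul, sub_self]
  simp only [gossipSubstep, hW.sum_smul_sub]
  rw [Finset.sum_add_distrib, ← Finset.smul_sum, h, smul_zero, add_zero]

lemma IsGossipMatrix.agentMean_gossipSubstep (hW : IsGossipMatrix 𝒢 W) (γ : ℝ) (C : Ξ → H → H)
    (s : Fin N → Ξ) (p : (Fin N → H) × (Fin N → H)) :
    agentMean (gossipSubstep W γ C s p).1 = agentMean p.1 := by
  rw [agentMean, hW.sum_gossipSubstep, agentMean]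

/-- The stacked tracking errors `Z - Ẑ`. -/
noncomputable def trackingError (p : (Fin N → H) × (Fin N → H)) : PiLp 2 (fun _ : Fin N => H) :=
  WithLp.toLp 2 fun n => p.1 n - p.2 n

/-- The stacked errors that the compressor makes in a substep. -/
noncomputable def compressionError (C : Ξ → H → H) (s : Fin N → Ξ) (p : (Fin N → H) × (Fin N → H)) :
    PiLp 2 (fun _ : Fin N => H) :=
  WithLp.toLp 2 fun n => C (s n) (p.1 n - p.2 n) - (p.1 n - p.2 n)

/-- The clean states move by the gossip operator applied to the disagreement and to the compression
error; the average drops out because `W` fixes constants. -/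
lemma IsGossipMatrix.gossipSubstep_fst_eq (hW : IsGossipMatrix 𝒢 W) (γ : ℝ) (C : Ξ → H → H)
    (s : Fin N → Ξ) (p : (Fin N → H) × (Fin N → H)) (n : Fin N) :
    (gossipSubstep W γ C s p).1 n = p.1 n +
      γ • ((mix W (fun n => p.1 n - agentMean p.1) n - (p.1 n - agentMean p.1)) +
        (mix W (compressionError C s p) n - compressionError C s p n)) := by
  simp only [gossipSubstep]
  congr 2
  rw [hW.sum_smul_sub (fun m => p.2 m + C (s m) (p.1 m - p.2 m))]
  have hY : (fun m => p.2 m + C (s m) (p.1 m - p.2 m)) =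
      fun m => ((p.1 m - agentMean p.1) + compressionError C s p m) + agentMean p.1 := by
    funext m
    simp only [compressionError]
    abel
  have hmix : ∀ (x y : Fin N → H) (c : H),
      mix W (fun m => (x m + y m) + c) n = mix W x n + mix W y n + c := fun x y c => by
    simp only [mix, smul_add, Finset.sum_add_distrib, ← Finset.sum_smul, hW.sum_row, one_smul]
  rw [hY, hmix, congrFun hY n]
  abel

lemma IsGossipMatrix.norm_disagreement_gossipSubstep_le (hW : IsGossipMatrix 𝒢 W) (hN : 0 < N)
    {ρ : ℝ} (hρ : IsContractionFactor W ρ) {γ : ℝ} (hγ0 : 0 ≤ γ) (hγ1 : γ ≤ 1)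
    (C : Ξ → H → H) (s : Fin N → Ξ) (p : (Fin N → H) × (Fin N → H)) :
    ‖disagreement (gossipSubstep W γ C s p).1‖ ≤
      (1 - γ * (1 - ρ)) * ‖disagreement p.1‖ + 2 * γ * ‖compressionError C s p‖ := by
  have e : disagreement (gossipSubstep W γ C s p).1 =
      (1 - γ) • disagreement p.1 +
        γ • WithLp.toLp 2 (mix W (fun n => p.1 n - agentMean p.1)) +
        γ • (WithLp.toLp 2 (mix W (compressionError C s p)) -
          WithLp.toLp 2 (compressionError C s p).ofLp) := by
    ext n
    simp only [disagreement, hW.agentMean_gossipSubstep, hW.gossipSubstep_fst_eq, PiLp.add_apply,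
      PiLp.smul_apply, PiLp.sub_apply]
    module
  have h1 := hρ.norm_mix_le _ (sum_sub_agentMean hN p.1)
  have h2 := hW.norm_mix_sub_le (compressionError C s p).ofLp
  rw [e]
  refine (norm_add₃_le).trans ?_
  rw [norm_smul, norm_smul, norm_smul, Real.norm_of_nonneg hγ0,
    Real.norm_of_nonneg (sub_nonneg.2 hγ1)]
  have h1' := mul_le_mul_of_nonneg_left h1 hγ0
  have h2' := mul_le_mul_of_nonneg_left h2 hγ0
  change _ ≤ (1 - γ * (1 - ρ)) * ‖disagreement p.1‖ +
    2 * γ * ‖WithLp.toLp 2 (compressionError C s p).ofLp‖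
  change γ * _ ≤ γ * (ρ * ‖disagreement p.1‖) at h1'
  linarith

lemma IsGossipMatrix.norm_trackingError_gossipSubstep_le (hW : IsGossipMatrix 𝒢 W) {γ : ℝ}
    (hγ0 : 0 ≤ γ) (C : Ξ → H → H) (s : Fin N → Ξ) (p : (Fin N → H) × (Fin N → H)) :
    ‖trackingError (gossipSubstep W γ C s p)‖ ≤
      2 * γ * ‖disagreement p.1‖ + (1 + 2 * γ) * ‖compressionError C s p‖ := by
  have e : trackingError (gossipSubstep W γ C s p) =
      γ • (WithLp.toLp 2 (mix W (fun n => p.1 n - agentMean p.1)) - disagreement p.1) +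
        γ • (WithLp.toLp 2 (mix W (compressionError C s p)) -
          WithLp.toLp 2 (compressionError C s p).ofLp) +
        -compressionError C s p := by
    ext n
    have h2 : (gossipSubstep W γ C s p).2 n = p.1 n + compressionError C s p n := by
      simp only [gossipSubstep, compressionError]; abel
    simp only [trackingError, hW.gossipSubstep_fst_eq, h2, PiLp.add_apply, PiLp.smul_apply,
      PiLp.sub_apply, PiLp.neg_apply, disagreement]
    module
  have h1 := hW.norm_mix_sub_le (fun n => p.1 n - agentMean p.1)
  have h2 := hW.norm_mix_sub_le (compressionError C s p).ofLp
  rw [e]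
  refine (norm_add₃_le).trans ?_
  rw [norm_smul, norm_smul, norm_neg, Real.norm_of_nonneg hγ0]
  have h1' := mul_le_mul_of_nonneg_left h1 hγ0
  have h2' := mul_le_mul_of_nonneg_left h2 hγ0
  change γ * ‖_ - disagreement p.1‖ ≤ γ * (2 * ‖disagreement p.1‖) at h1'
  change γ * _ ≤ γ * (2 * ‖compressionError C s p‖) at h2'
  linarith

end Mixing

/-! ### Measurability and mean-square error of random compression -/

section Compression

variable {H : Type*} [NormedAddCommGroup H] [MeasurableSpace H] [BorelSpace H]
  {Ξ : Type*} [MeasurableSpace Ξ] {ν : Measure Ξ} {C : Ξ → H → H} {α : ℝ} {Ω : Type*}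

lemma IsCompressor.stronglyMeasurable_comp (hC : IsCompressor ν C α) {m : MeasurableSpace Ω}
    {s : Ω → Ξ} {V : Ω → H} (hs : Measurable s) (hV : StronglyMeasurable V) :
    StronglyMeasurable fun ω => C (s ω) (V ω) :=
  (hC.measurable (Set.range V) hV.isSeparable_range).comp_measurable
    (g := fun ω => (s ω, (⟨V ω, Set.mem_range_self ω⟩ : Set.range V)))
    (hs.prodMk (hV.measurable.subtype_mk))

/-- A seed that is independent of the history compresses a history-measurable vector as well as it
would compress a constant one: integrate first over the seed. -/
lemma IsCompressor.lintegral_sq_le [IsProbabilityMeasure ν] (hC : IsCompressor ν C α)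
    {m mΩ : MeasurableSpace Ω} {P : Measure Ω} [IsProbabilityMeasure P] (hm : m ≤ mΩ)
    {s : Ω → Ξ} (hs : MeasurePreserving s P ν) {V : Ω → H} (hV : StronglyMeasurable[m] V)
    (hind : Indep (MeasurableSpace.comap s inferInstance) m P) :
    ∫⁻ ω, ENNReal.ofReal (‖C (s ω) (V ω) - V ω‖ ^ 2) ∂P ≤
      ENNReal.ofReal α * ∫⁻ ω, ENNReal.ofReal (‖V ω‖ ^ 2) ∂P := by
  have hsep : TopologicalSpace.IsSeparable (Set.range V) := hV.isSeparable_range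
  have : TopologicalSpace.SeparableSpace (Set.range V) := hsep.separableSpace
  have : SecondCountableTopology (Set.range V) :=
    UniformSpace.secondCountable_of_separable _
  let V' : Ω → Set.range V := fun ω => ⟨V ω, Set.mem_range_self ω⟩
  have hV'm : Measurable[m] V' := Measurable.subtype_mk hV.measurable
  have hV' : Measurable V' := hV'm.mono hm le_rfl
  have hindep : IndepFun s V' P :=
    (IndepFun_iff_Indep _ _ _).2 (indep_of_indep_of_le_right hind hV'm.comap_le)
  have hlaw := (indepFun_iff_map_prod_eq_prod_map_map hs.aemeasurable hV'.aemeasurable).1 hindep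
  rw [hs.map_eq] at hlaw
  let Φ : Ξ × Set.range V → ENNReal := fun p => ENNReal.ofReal (‖C p.1 p.2 - p.2‖ ^ 2)
  have hΦ : Measurable Φ := by
    have h1 : StronglyMeasurable fun p : Ξ × Set.range V => (p.2 : H) :=
      (continuous_subtype_val.stronglyMeasurable).comp_measurable measurable_snd
    exact (((hC.measurable _ hsep).sub h1).norm.measurable.pow_const 2).ennreal_ofReal
  have : IsProbabilityMeasure (P.map V') := Measure.isProbabilityMeasure_map hV'.aemeasurable
  calc ∫⁻ ω, ENNReal.ofReal (‖C (s ω) (V ω) - V ω‖ ^ 2) ∂P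
      = ∫⁻ ω, Φ (s ω, V' ω) ∂P := rfl
    _ = ∫⁻ p, Φ p ∂(ν.prod (P.map V')) := by
        rw [← hlaw, lintegral_map hΦ (hs.measurable.prodMk hV')]
    _ = ∫⁻ v, ∫⁻ σ, Φ (σ, v) ∂ν ∂(P.map V') := lintegral_prod_symm' _ hΦ
    _ ≤ ∫⁻ v : Set.range V, ENNReal.ofReal (α * ‖(v : H)‖ ^ 2) ∂(P.map V') :=
        lintegral_mono fun v => hC.residual v
    _ = ∫⁻ ω, ENNReal.ofReal (α * ‖V ω‖ ^ 2) ∂P := by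
        rw [lintegral_map _ hV']
        exact ((continuous_subtype_val.norm.measurable.pow_const 2).const_mul α).ennreal_ofReal
    _ = _ := by
        simp only [ENNReal.ofReal_mul hC.nonneg]
        exact lintegral_const_mul' _ _ ENNReal.ofReal_ne_top

end Compression

/-! ### Mean-square Lyapunov bound for the gossip loop -/

section Lyapunov

lemma eLpNorm_two_sq {Ω E : Type*} [NormedAddCommGroup E] {mΩ : MeasurableSpace Ω}
    (P : Measure Ω) (f : Ω → E) :
    eLpNorm f 2 P ^ 2 = ∫⁻ ω, ENNReal.ofReal (‖f ω‖ ^ 2) ∂P := by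
  have h := eLpNorm_nnreal_pow_eq_lintegral (f := f) (μ := P) (p := 2) two_ne_zero
  simp only [NNReal.coe_ofNat, ENNReal.coe_ofNat, ENNReal.rpow_ofNat] at h
  rw [h]
  refine lintegral_congr fun ω => ?_
  rw [ENNReal.ofReal_pow (norm_nonneg _), ofReal_norm]

lemma eLpNorm_two_le_of_norm_le {Ω : Type*} {mΩ : MeasurableSpace Ω} {P : Measure Ω}
    {f g h : Ω → ℝ} (hg : AEStronglyMeasurable g P) (hh : AEStronglyMeasurable h P) {a b x y : ℝ}
    (ha : 0 ≤ a) (hb : 0 ≤ b) (hx0 : 0 ≤ x) (hy0 : 0 ≤ y) (hle : ∀ ω, |f ω| ≤ a * g ω + b * h ω)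
    (hx : eLpNorm g 2 P ≤ ENNReal.ofReal x) (hy : eLpNorm h 2 P ≤ ENNReal.ofReal y) :
    eLpNorm f 2 P ≤ ENNReal.ofReal (a * x + b * y) := by
  calc eLpNorm f 2 P ≤ eLpNorm (a • g + b • h) 2 P := eLpNorm_mono_real hle
    _ ≤ eLpNorm (a • g) 2 P + eLpNorm (b • h) 2 P :=
        eLpNorm_add_le (hg.const_smul a) (hh.const_smul b) (by norm_num)
    _ ≤ ENNReal.ofReal a * ENNReal.ofReal x + ENNReal.ofReal b * ENNReal.ofReal y := by
        rw [eLpNorm_const_smul, eLpNorm_const_smul, Real.enorm_of_nonneg ha,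
          Real.enorm_of_nonneg hb]
        gcongr
    _ = ENNReal.ofReal (a * x + b * y) := by
        rw [← ENNReal.ofReal_mul ha, ← ENNReal.ofReal_mul hb,
          ← ENNReal.ofReal_add (by positivity) (by positivity)]

variable {H : Type*} [NormedAddCommGroup H] {N : ℕ} {Ω : Type*}

lemma stronglyMeasurable_norm_toLp {m : MeasurableSpace Ω} {z : Fin N → Ω → H}
    (hz : ∀ n, StronglyMeasurable (z n)) :
    StronglyMeasurable fun ω => ‖WithLp.toLp 2 fun n => z n ω‖ := by
  simp only [PiLp.norm_eq_of_L2]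
  exact (Real.continuous_sqrt.measurable.comp
    (Finset.measurable_sum _ fun n _ => (hz n).norm.measurable.pow_const 2)).stronglyMeasurable

/-- A random pair of stacked states is measurable with respect to a history. -/
structure PairMeasurable (m : MeasurableSpace Ω) (p : Ω → (Fin N → H) × (Fin N → H)) : Prop where
  fst : ∀ n, StronglyMeasurable[m] fun ω => (p ω).1 n
  snd : ∀ n, StronglyMeasurable[m] fun ω => (p ω).2 n

lemma PairMeasurable.mono {m m' : MeasurableSpace Ω} {p : Ω → (Fin N → H) × (Fin N → H)}
    (hp : PairMeasurable m p) (hm : m ≤ m') : PairMeasurable m' p :=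
  ⟨fun n => (hp.fst n).mono hm, fun n => (hp.snd n).mono hm⟩

lemma PairMeasurable.norm_trackingError {m : MeasurableSpace Ω}
    {p : Ω → (Fin N → H) × (Fin N → H)} (hp : PairMeasurable m p) :
    StronglyMeasurable[m] fun ω => ‖trackingError (p ω)‖ :=
  stronglyMeasurable_norm_toLp fun n => (hp.fst n).sub (hp.snd n)

lemma IsCompressor.eLpNorm_compressionError_le [MeasurableSpace H] [BorelSpace H]
    {Ξ : Type*} [MeasurableSpace Ξ] {ν : Measure Ξ} [IsProbabilityMeasure ν] {C : Ξ → H → H} {α : ℝ}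
    (hC : IsCompressor ν C α) {m mΩ : MeasurableSpace Ω} {P : Measure Ω} [IsProbabilityMeasure P]
    (hm : m ≤ mΩ) {s : Fin N → Ω → Ξ}
    {p : Ω → (Fin N → H) × (Fin N → H)} (hs : ∀ n, MeasurePreserving (s n) P ν)
    (hind : ∀ n, Indep (MeasurableSpace.comap (s n) inferInstance) m P)
    (hp : PairMeasurable m p) :
    eLpNorm (fun ω => ‖compressionError C (fun n => s n ω) (p ω)‖) 2 P ≤
      ENNReal.ofReal √α * eLpNorm (fun ω => ‖trackingError (p ω)‖) 2 P := by
  have hV : ∀ n, StronglyMeasurable[m] fun ω => (p ω).1 n - (p ω).2 n := fun n =>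
    (hp.fst n).sub (hp.snd n)
  have hCV : ∀ n, StronglyMeasurable fun ω => C (s n ω) ((p ω).1 n - (p ω).2 n) := fun n =>
    hC.stronglyMeasurable_comp (hs n).measurable ((hV n).mono hm)
  rw [← ENNReal.pow_le_pow_left_iff two_ne_zero, mul_pow, eLpNorm_two_sq, eLpNorm_two_sq,
    ← ENNReal.ofReal_pow (Real.sqrt_nonneg _), Real.sq_sqrt hC.nonneg]
  simp only [norm_norm, compressionError, trackingError, PiLp.norm_sq_eq_of_L2]
  have hsum : ∀ z : Fin N → Ω → H, (∀ n, StronglyMeasurable (z n)) →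
      ∫⁻ ω, ENNReal.ofReal (∑ n, ‖z n ω‖ ^ 2) ∂P =
        ∑ n, ∫⁻ ω, ENNReal.ofReal (‖z n ω‖ ^ 2) ∂P := fun z hz => by
    rw [← lintegral_finsetSum _ fun n _ => ((hz n).norm.measurable.pow_const 2).ennreal_ofReal]
    exact lintegral_congr fun ω => ENNReal.ofReal_sum_of_nonneg fun n _ => sq_nonneg _
  have hR : ∀ n, StronglyMeasurable fun ω =>
      C (s n ω) ((p ω).1 n - (p ω).2 n) - ((p ω).1 n - (p ω).2 n) := fun n =>
    (hCV n).sub ((hV n).mono hm)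
  rw [hsum _ hR, hsum _ fun n => (hV n).mono hm,
    Finset.mul_sum]
  exact Finset.sum_le_sum fun n _ => hC.lintegral_sq_le hm (hs n) (hV n) (hind n)

variable [InnerProductSpace ℝ H]

lemma stronglyMeasurable_agentMean {m : MeasurableSpace Ω} {z : Fin N → Ω → H}
    (hz : ∀ n, StronglyMeasurable (z n)) :
    StronglyMeasurable fun ω => agentMean fun n => z n ω := by
  unfold agentMean
  exact (Finset.stronglyMeasurable_fun_sum _ fun n _ => hz n).const_smul _

lemma PairMeasurable.norm_disagreement {m : MeasurableSpace Ω}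
    {p : Ω → (Fin N → H) × (Fin N → H)} (hp : PairMeasurable m p) :
    StronglyMeasurable[m] fun ω => ‖disagreement (p ω).1‖ :=
  stronglyMeasurable_norm_toLp fun n => (hp.fst n).sub (stronglyMeasurable_agentMean hp.fst)

/-- The Lyapunov function `‖Z - Z̄‖ + χ ‖Z - Ẑ‖`, with the norms taken in `L²` of the probability
space and of the agents, is at most `v`.  The `L²` norms are bounded by real witnesses, so that the
bound includes their finiteness. -/
def LyapunovBound {mΩ : MeasurableSpace Ω} (P : Measure Ω) (χ v : ℝ)
    (p : Ω → (Fin N → H) × (Fin N → H)) : Prop :=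
  ∃ d e : ℝ, 0 ≤ d ∧ 0 ≤ e ∧
    eLpNorm (fun ω => ‖disagreement (p ω).1‖) 2 P ≤ ENNReal.ofReal d ∧
    eLpNorm (fun ω => ‖trackingError (p ω)‖) 2 P ≤ ENNReal.ofReal e ∧ d + χ * e ≤ v

/-- Adding negative subgradients of norm at most one raises the Lyapunov function by at most
`(2 + χ) √N`. -/
lemma LyapunovBound.sub_bounded {m mΩ : MeasurableSpace Ω} {P : Measure Ω}
    [IsProbabilityMeasure P] {χ : ℝ} (hN : 0 < N) (hm : m ≤ mΩ) {p : Ω → (Fin N → H) × (Fin N → H)}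
    (hp : PairMeasurable m p) {g : Fin N → Ω → H} (hg : ∀ n ω, ‖g n ω‖ ≤ 1) {v : ℝ}
    (hv : LyapunovBound P χ v p) :
    LyapunovBound P χ (v + (2 + χ) * √N) fun ω => (fun n => (p ω).1 n + -g n ω, (p ω).2) := by
  obtain ⟨d, e, hd0, he0, hd, he, hde⟩ := hv
  have hone : AEStronglyMeasurable (fun _ : Ω => (1 : ℝ)) P := aestronglyMeasurable_const
  have hone' : eLpNorm (fun _ : Ω => (1 : ℝ)) 2 P ≤ ENNReal.ofReal 1 := by
    rw [eLpNorm_const _ two_ne_zero (IsProbabilityMeasure.ne_zero P)]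
    simp
  refine ⟨1 * d + √N * 2 * 1, 1 * e + √N * 1 * 1, by positivity, by positivity, ?_, ?_, ?_⟩
  · refine eLpNorm_two_le_of_norm_le (hp.mono hm).norm_disagreement.aestronglyMeasurable hone
      zero_le_one (by positivity) hd0 zero_le_one (fun ω => ?_) hd hone'
    have hmean : ‖agentMean fun n => g n ω‖ ≤ 1 := norm_agentMean_le hN fun n => hg n ω
    have e1 : disagreement (fun n => (p ω).1 n + -g n ω) =
        disagreement (p ω).1 - WithLp.toLp 2 (fun n => g n ω - agentMean fun n => g n ω) := by
      ext n
      simp only [disagreement, PiLp.sub_apply, agentMean, Finset.sum_add_distrib,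
        Finset.sum_neg_distrib, smul_add, smul_neg]
      abel
    rw [abs_norm, e1, one_mul, mul_one]
    refine (norm_sub_le _ _).trans ?_
    gcongr
    refine norm_toLp_le_sqrt_mul zero_le_two fun n => ?_
    refine (norm_sub_le _ _).trans ?_
    linarith [hg n ω]
  · refine eLpNorm_two_le_of_norm_le (hp.mono hm).norm_trackingError.aestronglyMeasurable hone
      zero_le_one (by positivity) he0 zero_le_one (fun ω => ?_) he hone'
    have e1 : trackingError (fun n => (p ω).1 n + -g n ω, (p ω).2) =
        trackingError (p ω) - WithLp.toLp 2 (fun n => g n ω) := by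
      ext n
      simp only [trackingError, PiLp.sub_apply]
      abel
    rw [abs_norm, e1, one_mul, mul_one]
    refine (norm_sub_le _ _).trans ?_
    gcongr
    exact norm_toLp_le_sqrt_mul zero_le_one fun n => hg n ω
  · linarith

variable [MeasurableSpace H] [BorelSpace H] {Ξ : Type*} [MeasurableSpace Ξ] {ν : Measure Ξ}
  {C : Ξ → H → H} {α : ℝ}

lemma IsCompressor.pairMeasurable_gossipSubstep (hC : IsCompressor ν C α) {m : MeasurableSpace Ω}
    (W : Matrix (Fin N) (Fin N) ℝ) (γ : ℝ) {s : Fin N → Ω → Ξ}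
    {p : Ω → (Fin N → H) × (Fin N → H)} (hs : ∀ n, Measurable[m] (s n))
    (hp : PairMeasurable m p) :
    PairMeasurable m fun ω => gossipSubstep W γ C (fun n => s n ω) (p ω) := by
  have hY : ∀ n, StronglyMeasurable[m] fun ω =>
      (p ω).2 n + C (s n ω) ((p ω).1 n - (p ω).2 n) := fun n =>
    (hp.snd n).add (hC.stronglyMeasurable_comp (hs n) ((hp.fst n).sub (hp.snd n)))
  refine ⟨fun n => ?_, hY⟩
  exact (hp.fst n).add ((Finset.stronglyMeasurable_fun_sum _ fun j _ =>
    ((hY j).sub (hY n)).const_smul (W n j)).const_smul γ)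

variable {𝒢 : SimpleGraph (Fin N)} {W : Matrix (Fin N) (Fin N) ℝ}

/-- One compressed gossip substep contracts the Lyapunov function by the tracker rate; the step
size condition is what absorbs the compression error into the tracking term. -/
lemma LyapunovBound.gossipSubstep [IsProbabilityMeasure ν] {m mΩ : MeasurableSpace Ω}
    {P : Measure Ω} [IsProbabilityMeasure P]
    (hW : IsGossipMatrix 𝒢 W) (hN : 0 < N) {ρ : ℝ} (hρ : IsContractionFactor W ρ)
    (hC : IsCompressor ν C α) {γ : ℝ} (hγ0 : 0 < γ) (hγ : γ ≤ maxStepSize α ρ)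
    (hm : m ≤ mΩ) {s : Fin N → Ω → Ξ}
    {p : Ω → (Fin N → H) × (Fin N → H)} (hs : ∀ n, MeasurePreserving (s n) P ν)
    (hind : ∀ n, Indep (MeasurableSpace.comap (s n) inferInstance) m P)
    (hp : PairMeasurable m p) {v : ℝ} (hv : LyapunovBound P ((1 - ρ) / 4) v p) :
    LyapunovBound P ((1 - ρ) / 4) (trackerRate γ ρ * v)
      fun ω => gossipSubstep W γ C (fun n => s n ω) (p ω) := by
  obtain ⟨d, e, hd0, he0, hd, he, hde⟩ := hv
  have hμ0 : 0 < 1 - ρ := by linarith [hρ.lt_one]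
  have hμ1 : 1 - ρ ≤ 1 := by linarith [hρ.nonneg]
  have hγ1 : γ ≤ 1 := hγ.trans (min_le_left _ _)
  obtain ⟨r, hr⟩ : ∃ r, r = √α := ⟨_, rfl⟩
  have hr0 : 0 ≤ r := by rw [hr]; positivity
  have hstep : γ * (2 * r * (1 + 4 / (1 - ρ)) + (1 - ρ) / 2) ≤ 1 - r := by
    have h := hγ.trans (min_le_right _ _)
    rwa [← hr, le_div_iff₀ (by positivity)] at h
  have hcomp : eLpNorm (fun ω => ‖compressionError C (fun n => s n ω) (p ω)‖) 2 P ≤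
      ENNReal.ofReal (r * e) := by
    refine (hC.eLpNorm_compressionError_le hm hs hind hp).trans ?_
    rw [← hr, ENNReal.ofReal_mul hr0]
    gcongr
  have hD : AEStronglyMeasurable (fun ω => ‖disagreement (p ω).1‖) P :=
    (hp.mono hm).norm_disagreement.aestronglyMeasurable
  have hR : AEStronglyMeasurable
      (fun ω => ‖compressionError C (fun n => s n ω) (p ω)‖) P :=
    (stronglyMeasurable_norm_toLp fun n =>
      ((hC.stronglyMeasurable_comp (hs n).measurable (((hp.mono hm).fst n).sub
        ((hp.mono hm).snd n))).sub (((hp.mono hm).fst n).sub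
        ((hp.mono hm).snd n)))).aestronglyMeasurable
  have hcoef : 0 ≤ 1 - γ * (1 - ρ) := by nlinarith
  refine ⟨(1 - γ * (1 - ρ)) * d + 2 * γ * (r * e), 2 * γ * d + (1 + 2 * γ) * (r * e),
    by positivity, by positivity, ?_, ?_, ?_⟩
  · refine eLpNorm_two_le_of_norm_le hD hR hcoef (by positivity) hd0 (by positivity)
      (fun ω => ?_) hd hcomp
    rw [abs_norm]
    exact hW.norm_disagreement_gossipSubstep_le hN hρ hγ0.le hγ1 C _ _
  · refine eLpNorm_two_le_of_norm_le hD hR (by positivity) (by positivity) hd0 (by positivity)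
      (fun ω => ?_) hd hcomp
    rw [abs_norm]
    exact hW.norm_trackingError_gossipSubstep_le hγ0.le C _ _
  · have hη : 0 ≤ trackerRate γ ρ := by rw [trackerRate]; nlinarith
    have hkey : 2 * γ * r + (1 - ρ) / 4 * ((1 + 2 * γ) * r) ≤
        (1 - ρ) / 4 * trackerRate γ ρ := by
      have h1 : 2 * γ * r + (1 - ρ) / 4 * ((1 + 2 * γ) * r) =
          (1 - ρ) / 4 * (r + γ * (2 * r * (1 + 4 / (1 - ρ)))) := by
        field_simp; ring
      rw [h1, trackerRate]
      exact mul_le_mul_of_nonneg_left (by linarith) (by positivity)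
    have h2 := mul_le_mul_of_nonneg_right hkey he0
    have h3 := mul_le_mul_of_nonneg_left hde hη
    rw [trackerRate] at h2 h3 ⊢
    linarith

end Lyapunov

/-! ### The Lyapunov bound along a run -/

lemma IsSubgradientAt.norm_le_one {H : Type*} [NormedAddCommGroup H] [InnerProductSpace ℝ H]
    {f : H → ℝ} {g x : H} (hg : IsSubgradientAt f g x) (hf : LipschitzWith 1 f) : ‖g‖ ≤ 1 := by
  have h1 := hg (x + g)
  have h2 := hf.dist_le_mul (x + g) x
  rw [Real.dist_eq, dist_eq_norm, add_sub_cancel_left, NNReal.coe_one, one_mul] at h2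
  rw [add_sub_cancel_left, real_inner_self_eq_norm_sq] at h1
  have h3 := (le_abs_self _).trans h2
  by_contra! hcon
  nlinarith

/-- The recursive bound on the Lyapunov function at the beginning of round `t`, when every round
adds `B` and the gossip substeps of round `t` contract by `η ^ q t`. -/
noncomputable def roundBound (η B : ℝ) (q : ℕ → ℕ) : ℕ → ℝ
  | 0 => 0
  | t + 1 => η ^ q t * (roundBound η B q t + B)

lemma roundBound_nonneg {η B : ℝ} (hη : 0 ≤ η) (hB : 0 ≤ B) (q : ℕ → ℕ) (t : ℕ) :
    0 ≤ roundBound η B q t := by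
  induction t with
  | zero => exact le_rfl
  | succ t ih => exact mul_nonneg (pow_nonneg hη _) (by linarith)

lemma roundBound_le {η B θ : ℝ} (hη : 0 ≤ η) (hB : 0 ≤ B) (hθ0 : 0 ≤ θ) (hθ : θ ≤ 1 / 2)
    {q : ℕ → ℕ} (hq : ∀ t, η ^ q t ≤ θ ^ t) (t : ℕ) :
    θ * roundBound η B q t ≤ 2 * B * θ ^ t := by
  have hnn := roundBound_nonneg hη hB q
  have hle : ∀ t, roundBound η B q t ≤ B := fun t => by
    induction t with
    | zero => exact hB
    | succ t ih =>
      rw [roundBound]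
      rcases t.eq_zero_or_pos with rfl | ht
      · have := hq 0
        rw [pow_zero] at this
        rw [show roundBound η B q 0 = 0 from rfl]
        nlinarith
      · have h1 : η ^ q t ≤ 1 / 2 := (hq t).trans
          ((pow_le_of_le_one hθ0 (by linarith) ht.ne').trans hθ)
        nlinarith [hnn t, pow_nonneg hη (q t)]
  cases t with
  | zero =>
    rw [show roundBound η B q 0 = 0 from rfl]
    simpa using hB
  | succ t =>
    rw [roundBound, pow_succ]
    have h1 := hq t
    have h2 := hle t
    have h3 := hnn t
    calc θ * (η ^ q t * (roundBound η B q t + B)) ≤ θ * (θ ^ t * (B + B)) := by gcongr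
      _ = _ := by ring

section Run

variable {H : Type*} [NormedAddCommGroup H] [InnerProductSpace ℝ H] {N : ℕ}
  {𝒢 : SimpleGraph (Fin N)} {W : Matrix (Fin N) (Fin N) ℝ} {Ξ : Type*} [MeasurableSpace Ξ]
  {ν : Measure Ξ} {C : Ξ → H → H} {α : ℝ} {Ω : Type*} {mΩ : MeasurableSpace Ω} {P : Measure Ω}
  {𝓕 : Filtration ℕ mΩ} {F : ℕ → ℝ → ℝ} {γ ρ : ℝ} {q : ℕ → ℕ}
  {ξ : ℕ → ℕ → Fin N → Ω → Ξ} {l : ℕ → Fin N → Ω → H → ℝ} {g : ℕ → Fin N → Ω → H}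

/-- The states of a run at the beginning of round `t`. -/
noncomputable def runState (W : Matrix (Fin N) (Fin N) ℝ) (γ : ℝ) (q : ℕ → ℕ) (C : Ξ → H → H)
    (ξ : ℕ → ℕ → Fin N → Ω → Ξ) (g : ℕ → Fin N → Ω → H) (t : ℕ) (ω : Ω) :
    (Fin N → H) × (Fin N → H) :=
  decoState W γ q C (fun t k n => ξ t k n ω) (fun t n => g t n ω) t

lemma IsDecoRun.norm_grad_le (hrun : IsDecoRun ν P 𝓕 F W γ q C ξ l g) (t : ℕ) (n : Fin N) (ω : Ω) :
    ‖g t n ω‖ ≤ 1 :=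
  (hrun.grad_subgradient t n ω).norm_le_one (hrun.loss_lipschitz t n ω)

variable [MeasurableSpace H] [BorelSpace H] [IsProbabilityMeasure ν] [IsProbabilityMeasure P]

/-- Within a round, the states after `k` substeps are measurable with respect to the history before
substep `k`, and every substep contracts the Lyapunov function. -/
lemma IsDecoRun.gossipLoop_bound (hW : IsGossipMatrix 𝒢 W) (hN : 0 < N)
    (hρ : IsContractionFactor W ρ) (hC : IsCompressor ν C α) (hγ0 : 0 < γ)
    (hγ : γ ≤ maxStepSize α ρ) (hrun : IsDecoRun ν P 𝓕 F W γ q C ξ l g) (t : ℕ)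
    {p : Ω → (Fin N → H) × (Fin N → H)} (hp : PairMeasurable (𝓕 t) p) {v : ℝ}
    (hv : LyapunovBound P ((1 - ρ) / 4) v p) (k : ℕ) (hk : k ≤ q t) :
    PairMeasurable
        (𝓕 t ⊔ ⨆ j : Fin k, ⨆ m : Fin N, MeasurableSpace.comap (ξ t j m) inferInstance)
        (fun ω => gossipLoop W γ C (fun j n => ξ t j n ω) (p ω) k) ∧
      LyapunovBound P ((1 - ρ) / 4) (trackerRate γ ρ ^ k * v)
        (fun ω => gossipLoop W γ C (fun j n => ξ t j n ω) (p ω) k) := by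
  induction k with
  | zero => exact ⟨hp.mono le_sup_left, by rwa [pow_zero, one_mul]⟩
  | succ k ih =>
    obtain ⟨h1, h2⟩ := ih (Nat.le_of_succ_le hk)
    have hm : (𝓕 t ⊔ ⨆ j : Fin k, ⨆ m : Fin N, MeasurableSpace.comap (ξ t j m) inferInstance) ≤
        mΩ := sup_le (𝓕.le t) (iSup_le fun j => iSup_le fun n =>
      (hrun.seed_law t j (j.2.trans (Nat.lt_of_succ_le hk)) n).measurable.comap_le)
    refine ⟨?_, ?_⟩
    · refine hC.pairMeasurable_gossipSubstep W γ (s := fun n ω => ξ t k n ω) (fun n => ?_)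
        (h1.mono ?_)
      · rw [measurable_iff_comap_le]
        exact le_sup_of_le_right (le_iSup_of_le (Fin.last k) (le_iSup_of_le n le_rfl))
      · exact sup_le_sup_left (iSup_le fun j => le_iSup (fun i : Fin (k + 1) => ⨆ m : Fin N,
          MeasurableSpace.comap (ξ t i m) inferInstance) (Fin.castSucc j)) _
    · rw [pow_succ', mul_assoc]
      exact h2.gossipSubstep hW hN hρ hC hγ0 hγ hm (s := fun n ω => ξ t k n ω)
        (fun n => hrun.seed_law t k (Nat.lt_of_succ_le hk) n)
        (fun n => hrun.seed_fresh t k (Nat.lt_of_succ_le hk) n) h1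

lemma IsDecoRun.runState_bound (hW : IsGossipMatrix 𝒢 W) (hN : 0 < N)
    (hρ : IsContractionFactor W ρ) (hC : IsCompressor ν C α) (hγ0 : 0 < γ)
    (hγ : γ ≤ maxStepSize α ρ) (hrun : IsDecoRun ν P 𝓕 F W γ q C ξ l g) (t : ℕ) :
    PairMeasurable (𝓕 t) (runState W γ q C ξ g t) ∧
      LyapunovBound P ((1 - ρ) / 4)
        (roundBound (trackerRate γ ρ) ((2 + (1 - ρ) / 4) * √N) q t)
        (runState W γ q C ξ g t) := by
  induction t with
  | zero =>
    refine ⟨⟨fun n => stronglyMeasurable_const, fun n => stronglyMeasurable_const⟩,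
      0, 0, le_rfl, le_rfl, ?_, ?_, ?_⟩
    · have : ∀ ω, ‖disagreement (runState W γ q C ξ g 0 ω).1‖ = 0 := fun ω => by
        rw [norm_eq_zero]
        ext n
        simp [disagreement, runState, decoState, agentMean]
      simp [this]
    · have : ∀ ω, ‖trackingError (runState W γ q C ξ g 0 ω)‖ = 0 := fun ω => by
        rw [norm_eq_zero]
        ext n
        simp [trackingError, runState, decoState]
      simp [this]
    · simp [roundBound]
  | succ t ih =>
    have hstart := ih.2.sub_bounded hN (𝓕.le t) ih.1
      (g := g t) (fun n ω => hrun.norm_grad_le t n ω)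
    have hmeas : PairMeasurable (𝓕 t) fun ω =>
        ((fun n => (runState W γ q C ξ g t ω).1 n + -g t n ω, (runState W γ q C ξ g t ω).2) :
          (Fin N → H) × (Fin N → H)) :=
      ⟨fun n => (ih.1.fst n).add (hrun.grad_measurable t n).neg, ih.1.snd⟩
    obtain ⟨h1, h2⟩ :=
      hrun.gossipLoop_bound hW hN hρ hC hγ0 hγ t hmeas hstart (q t) le_rfl
    refine ⟨h1.mono (sup_le (𝓕.mono (Nat.le_succ t)) (iSup_le fun j => iSup_le fun n => ?_)), h2⟩
    exact (hrun.seed_revealed t j j.2 n).comap_le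

end Run

/-! ### Predictions and regret -/

section Prediction

/-- The regret is a mean of loss differences.  Unlike the losses themselves, these are bounded. -/
lemma networkRegret_eq {N : ℕ} (hN : 0 < N) {X : Type*} (l : ℕ → Fin N → X → ℝ)
    (x : ℕ → Fin N → X) (T : ℕ) (u : X) :
    networkRegret l x T u = ∑ t ∈ Finset.range T,
      (1 / (N : ℝ)) * ∑ n, (1 / (N : ℝ)) * ∑ m, (l t m (x t n) - l t m u) := by
  have hN' : (N : ℝ) ≠ 0 := Nat.cast_ne_zero.2 hN.ne'
  rw [networkRegret, ← Finset.sum_sub_distrib]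
  refine Finset.sum_congr rfl fun t _ => ?_
  simp only [networkLoss, Finset.sum_sub_distrib, mul_sub, Finset.sum_const, Finset.card_univ,
    Fintype.card_fin, nsmul_eq_mul]
  rw [sub_right_inj]
  field_simp

lemma mean_le_of_forall_le {N : ℕ} (hN : 0 < N) {f : Fin N → ℝ} {c : ℝ} (h : ∀ n, f n ≤ c) :
    (1 / (N : ℝ)) * ∑ n, f n ≤ c := by
  have hN' : (0 : ℝ) < N := Nat.cast_pos.2 hN
  rw [one_div, inv_mul_le_iff₀ hN']
  simpa using Finset.sum_le_sum fun n (_ : n ∈ Finset.univ) => h n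

variable {H : Type*} [NormedAddCommGroup H] [InnerProductSpace ℝ H] {F : ℕ → ℝ → ℝ} {ε : ℝ}

lemma IsBettingPotential.radialBet_normClip_lipschitz (hF : IsBettingPotential F ε) {t : ℕ} {L : ℝ}
    (hL : 0 ≤ L) (hlip : ∀ x y : ℝ, 0 ≤ y → y ≤ x → x ≤ t →
      |coinBet F (t + 1) x - coinBet F (t + 1) y| ≤ L * (x - y)) (A B : H) :
    ‖radialBet F (t + 1) (normClip t A) - radialBet F (t + 1) (normClip t B)‖ ≤ L * ‖A - B‖ :=
  (radial_lipschitz hL (hF.coinBet_zero (t + 1)) hlip _ _ (norm_normClip_le t A)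
    (norm_normClip_le t B)).trans (mul_le_mul_of_nonneg_left (normClip_lipschitz t A B) hL)

lemma IsBettingPotential.norm_radialBet_normClip_le (hF : IsBettingPotential F ε) {t : ℕ} {L : ℝ}
    (hL : 0 ≤ L) (hlip : ∀ x y : ℝ, 0 ≤ y → y ≤ x → x ≤ t →
      |coinBet F (t + 1) x - coinBet F (t + 1) y| ≤ L * (x - y)) (A : H) :
    ‖radialBet F (t + 1) (normClip t A)‖ ≤ L * t := by
  have h := radial_lipschitz hL (hF.coinBet_zero (t + 1)) hlip (normClip t A) 0
    (norm_normClip_le t A) (by simp)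
  rw [smul_zero, sub_zero, sub_zero] at h
  exact h.trans (mul_le_mul_of_nonneg_left (norm_normClip_le t A) hL)

variable {N : ℕ} {𝒢 : SimpleGraph (Fin N)} {W : Matrix (Fin N) (Fin N) ℝ} {Ξ : Type*}

/-- Gossip preserves the average, so the average of the clean states is the sum of the average
coins. -/
lemma IsGossipMatrix.agentMean_decoState (hW : IsGossipMatrix 𝒢 W) (γ : ℝ) (q : ℕ → ℕ)
    (C : Ξ → H → H) (s : ℕ → ℕ → Fin N → Ξ) (g : ℕ → Fin N → H) (t : ℕ) :
    agentMean (decoState W γ q C s g t).1 = ∑ i ∈ Finset.range t, -agentMean (g i) := by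
  have hloop : ∀ (σ : ℕ → Fin N → Ξ) (p : (Fin N → H) × (Fin N → H)) (k : ℕ),
      agentMean (gossipLoop W γ C σ p k).1 = agentMean p.1 := fun σ p k => by
    induction k with
    | zero => rfl
    | succ k ih => rw [gossipLoop, hW.agentMean_gossipSubstep, ih]
  induction t with
  | zero => simp [decoState, agentMean]
  | succ t ih =>
    rw [decoState, hloop, Finset.sum_range_succ, ← ih]
    simp only [agentMean, Finset.sum_add_distrib, Finset.sum_neg_distrib, smul_add, smul_neg]

/-- Deterministic regret bound: the regret is at most the regret of the betting algorithm that is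
fed with the average coins, plus three times the effect of the disagreement on the predictions.  An
agent is compared with the average twice when the loss of agent `m` is moved between the
predictions of `n` and `m`, and once more when the linearized loss is moved to the average. -/
lemma networkRegret_le (hW : IsGossipMatrix 𝒢 W) (hN : 0 < N) (hF : IsBettingPotential F ε)
    {L : ℕ → ℝ} (hL : ∀ t, 0 ≤ L t) (hlip : ∀ (t : ℕ) (x y : ℝ), 0 ≤ y → y ≤ x → x ≤ t →
      |coinBet F (t + 1) x - coinBet F (t + 1) y| ≤ L t * (x - y))
    {γ : ℝ} {q : ℕ → ℕ} {C : Ξ → H → H} {s : ℕ → ℕ → Fin N → Ξ} {l : ℕ → Fin N → H → ℝ}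
    {g : ℕ → Fin N → H} (hl : ∀ t n, LipschitzWith 1 (l t n))
    (hg : ∀ t n, IsSubgradientAt (l t n) (g t n) (decoPrediction F W γ q C s g t n))
    (T : ℕ) {a b : ℝ} (ha : 0 < a) (hb : 0 < b)
    (hlow : ∀ x : ℝ, 0 ≤ x → x ≤ T → b * Real.exp (x ^ 2 / (2 * a)) ≤ F T x) (u : H) :
    networkRegret l (decoPrediction F W γ q C s g) T u ≤
      ‖u‖ * √(a * Real.log (1 + a * ‖u‖ ^ 2 / b ^ 2)) + (ε - b) +
        3 * ∑ t ∈ Finset.range T, L t * ‖disagreement (decoState W γ q C s g t).1‖ := by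
  have hN' : (N : ℝ) ≠ 0 := Nat.cast_ne_zero.2 hN.ne'
  let c : ℕ → H := fun t => -agentMean (g t)
  have hc : ∀ t, ‖c t‖ ≤ 1 := fun t => by
    rw [norm_neg]
    exact norm_agentMean_le hN fun n => (hg t n).norm_le_one (hl t n)
  have hlin := hF.linear_regret_le hc T ha hb hlow u
  let y : ℕ → H := fun t => radialBet F (t + 1) (∑ i ∈ Finset.range t, c i)
  have hclose : ∀ t n, ‖decoPrediction F W γ q C s g t n - y t‖ ≤
      L t * ‖disagreement (decoState W γ q C s g t).1‖ := fun t n => by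
    have hmean : agentMean (decoState W γ q C s g t).1 = ∑ i ∈ Finset.range t, c i :=
      hW.agentMean_decoState γ q C s g t
    have hclip : normClip t (∑ i ∈ Finset.range t, c i) = ∑ i ∈ Finset.range t, c i :=
      if_pos (norm_sum_range_le_of_norm_le_one hc t)
    have h := hF.radialBet_normClip_lipschitz (hL t) (hlip t) ((decoState W γ q C s g t).1 n)
      (∑ i ∈ Finset.range t, c i)
    rw [hclip] at h
    refine h.trans (mul_le_mul_of_nonneg_left ?_ (hL t))
    rw [← hmean]
    exact norm_sub_agentMean_le _ n
  have hround : ∀ t, (1 / (N : ℝ)) * ∑ n, (1 / (N : ℝ)) *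
        ∑ m, (l t m (decoPrediction F W γ q C s g t n) - l t m u) ≤
      ⟪c t, u - y t⟫ + 3 * (L t * ‖disagreement (decoState W γ q C s g t).1‖) := fun t => by
    refine mean_le_of_forall_le hN fun n => ?_
    have hpair : ∀ m, l t m (decoPrediction F W γ q C s g t n) - l t m u ≤
        ⟪g t m, y t - u⟫ + 3 * (L t * ‖disagreement (decoState W γ q C s g t).1‖) := fun m => by
      obtain ⟨xn, hxn⟩ : ∃ x, x = decoPrediction F W γ q C s g t n := ⟨_, rfl⟩
      obtain ⟨xm, hxm⟩ : ∃ x, x = decoPrediction F W γ q C s g t m := ⟨_, rfl⟩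
      have h1 := hclose t n
      have h2 := hclose t m
      have h3 := hg t m u
      have h4 := (hl t m).dist_le_mul xn xm
      have hgm := (hg t m).norm_le_one (hl t m)
      rw [← hxn] at h1 ⊢
      rw [← hxm] at h2 h3
      rw [Real.dist_eq, NNReal.coe_one, one_mul, dist_eq_norm] at h4
      have h5 : ‖xn - xm‖ ≤ ‖xn - y t‖ + ‖xm - y t‖ := by
        rw [← norm_neg (xm - y t), neg_sub]
        simpa using norm_add_le (xn - y t) (y t - xm)
      have h6 : ⟪g t m, xm - y t⟫ ≤ ‖xm - y t‖ :=
        (real_inner_le_norm _ _).trans (mul_le_of_le_one_left (norm_nonneg _) hgm)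
      have h7 : ⟪g t m, u - xm⟫ = -⟪g t m, y t - u⟫ - ⟪g t m, xm - y t⟫ := by
        rw [← inner_neg_right, ← inner_sub_right]
        congr 1
        abel
      linarith [(le_abs_self _).trans h4]
    have hsum := Finset.sum_le_sum fun m (_ : m ∈ Finset.univ) => hpair m
    have hmean : (1 / (N : ℝ)) * ∑ m, ⟪g t m, y t - u⟫ = ⟪c t, u - y t⟫ := by
      simp only [c, agentMean]
      rw [inner_neg_left, real_inner_smul_left, sum_inner, ← mul_neg, ← Finset.sum_neg_distrib]
      congr 1
      refine Finset.sum_congr rfl fun m _ => ?_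
      rw [← inner_neg_right, neg_sub]
    have hscale := mul_le_mul_of_nonneg_left hsum (show 0 ≤ 1 / (N : ℝ) by positivity)
    rw [Finset.sum_add_distrib, mul_add, hmean, Finset.sum_const, Finset.card_univ,
      Fintype.card_fin, nsmul_eq_mul, ← mul_assoc (1 / (N : ℝ)), one_div_mul_cancel hN',
      one_mul] at hscale
    exact hscale
  rw [networkRegret_eq hN, Finset.mul_sum]
  have htotal := Finset.sum_le_sum fun t (_ : t ∈ Finset.range T) => hround t
  rw [Finset.sum_add_distrib] at htotal
  linarith

end Prediction

/-! ### Expected regret -/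

/-- Evaluation of a random continuous function at a random point; the point takes its values in a
separable set. -/
lemma measurable_apply_of_continuous {Ω H : Type*} {mΩ : MeasurableSpace Ω} [NormedAddCommGroup H]
    [MeasurableSpace H] [BorelSpace H] {l : Ω → H → ℝ} (hl : ∀ ω, Continuous (l ω))
    (hm : ∀ x, Measurable fun ω => l ω x) {x : Ω → H} (hx : StronglyMeasurable x) :
    Measurable fun ω => l ω (x ω) := by
  have hsep : TopologicalSpace.IsSeparable (Set.range x) := hx.isSeparable_range
  have : TopologicalSpace.SeparableSpace (Set.range x) := hsep.separableSpace
  have : SecondCountableTopology (Set.range x) :=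
    UniformSpace.secondCountable_of_separable _
  have h := stronglyMeasurable_uncurry_of_continuous_of_stronglyMeasurable
    (u := fun (v : Set.range x) (ω : Ω) => l ω v) (fun ω => (hl ω).comp continuous_subtype_val)
    (fun v => (hm v).stronglyMeasurable)
  exact h.measurable.comp
    ((hx.measurable.subtype_mk (h := fun ω => Set.mem_range_self ω)).prodMk measurable_id)

section Expectation

variable {H : Type*} [NormedAddCommGroup H] [InnerProductSpace ℝ H] [MeasurableSpace H]
  [BorelSpace H] {N : ℕ} {𝒢 : SimpleGraph (Fin N)} {W : Matrix (Fin N) (Fin N) ℝ}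
  {Ξ : Type*} [MeasurableSpace Ξ] {ν : Measure Ξ} [IsProbabilityMeasure ν]
  {C : Ξ → H → H} {α : ℝ} {Ω : Type*} {mΩ : MeasurableSpace Ω} {P : Measure Ω}
  [IsProbabilityMeasure P] {𝓕 : Filtration ℕ mΩ} {F : ℕ → ℝ → ℝ} {γ ρ : ℝ} {q : ℕ → ℕ}
  {ξ : ℕ → ℕ → Fin N → Ω → Ξ} {l : ℕ → Fin N → Ω → H → ℝ} {g : ℕ → Fin N → Ω → H} {ε : ℝ}

lemma IsDecoRun.integrable_decoRegret (hW : IsGossipMatrix 𝒢 W) (hN : 0 < N)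
    (hρ : IsContractionFactor W ρ) (hC : IsCompressor ν C α) (hγ0 : 0 < γ)
    (hγ : γ ≤ maxStepSize α ρ) (hF : IsBettingPotential F ε) {L : ℕ → ℝ} (hL : ∀ t, 0 ≤ L t)
    (hlip : ∀ (t : ℕ) (x y : ℝ), 0 ≤ y → y ≤ x → x ≤ t →
      |coinBet F (t + 1) x - coinBet F (t + 1) y| ≤ L t * (x - y))
    (hrun : IsDecoRun ν P 𝓕 F W γ q C ξ l g) (T : ℕ) (u : H) :
    Integrable (decoRegret F W γ q C ξ l g T u) P := by
  have hcont : ∀ t, Continuous fun A : H => radialBet F (t + 1) (normClip t A) := fun t =>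
    (LipschitzWith.of_dist_le_mul (K := (L t).toNNReal) fun A B => by
      rw [dist_eq_norm, dist_eq_norm, Real.coe_toNNReal _ (hL t)]
      exact hF.radialBet_normClip_lipschitz (hL t) (hlip t) A B).continuous
  have hpred : ∀ t n, StronglyMeasurable fun ω =>
      decoPrediction F W γ q C (fun t k n => ξ t k n ω) (fun t n => g t n ω) t n := fun t n =>
    (hcont t).comp_stronglyMeasurable
      (((hrun.runState_bound hW hN hρ hC hγ0 hγ t).1.fst n).mono (𝓕.le t))
  have hint : ∀ t m n, Integrable (fun ω => l t m ω (decoPrediction F W γ q C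
      (fun t k n => ξ t k n ω) (fun t n => g t n ω) t n) - l t m ω u) P := fun t m n => by
    refine Integrable.of_bound (C := L t * t + ‖u‖) ?_ (Filter.Eventually.of_forall fun ω => ?_)
    · have hlm : ∀ x, Measurable fun ω => l t m ω x := fun x =>
        (hrun.loss_measurable t m x).mono (𝓕.le t) le_rfl
      exact ((measurable_apply_of_continuous
        (fun ω => (hrun.loss_lipschitz t m ω).continuous) hlm (hpred t n)).sub
        (hlm u)).aestronglyMeasurable
    · have h := (hrun.loss_lipschitz t m ω).dist_le_mul (decoPrediction F W γ q C
        (fun t k n => ξ t k n ω) (fun t n => g t n ω) t n) u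
      rw [Real.dist_eq, NNReal.coe_one, one_mul, dist_eq_norm] at h
      refine h.trans ((norm_sub_le _ _).trans ?_)
      gcongr
      exact hF.norm_radialBet_normClip_le (hL t) (hlip t) _
  have heq : decoRegret F W γ q C ξ l g T u = fun ω => ∑ t ∈ Finset.range T,
      (1 / (N : ℝ)) * ∑ n, (1 / (N : ℝ)) * ∑ m, (l t m ω (decoPrediction F W γ q C
      (fun t k n => ξ t k n ω) (fun t n => g t n ω) t n) - l t m ω u) := by
    funext ω
    rw [decoRegret, networkRegret_eq hN]
  rw [heq]
  exact integrable_finsetSum _ fun t _ => (integrable_finsetSum _ fun n _ =>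
    (integrable_finsetSum _ fun m _ => hint t m n).const_mul _).const_mul _

lemma IsDecoRun.integral_norm_disagreement_le (hW : IsGossipMatrix 𝒢 W) (hN : 0 < N)
    (hρ : IsContractionFactor W ρ) (hC : IsCompressor ν C α) (hγ0 : 0 < γ)
    (hγ : γ ≤ maxStepSize α ρ) (hrun : IsDecoRun ν P 𝓕 F W γ q C ξ l g) (t : ℕ) :
    Integrable (fun ω => ‖disagreement (runState W γ q C ξ g t ω).1‖) P ∧
      ∫ ω, ‖disagreement (runState W γ q C ξ g t ω).1‖ ∂P ≤
        roundBound (trackerRate γ ρ) ((2 + (1 - ρ) / 4) * √N) q t := by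
  obtain ⟨hp, d, e, hd0, he0, hd, _, hde⟩ := hrun.runState_bound hW hN hρ hC hγ0 hγ t
  have hmeas : AEStronglyMeasurable
      (fun ω => ‖disagreement (runState W γ q C ξ g t ω).1‖) P :=
    (hp.mono (𝓕.le t)).norm_disagreement.aestronglyMeasurable
  have h1 : eLpNorm (fun ω => ‖disagreement (runState W γ q C ξ g t ω).1‖) 1 P ≤
      ENNReal.ofReal d := (eLpNorm_le_eLpNorm_of_exponent_le (by norm_num) hmeas).trans hd
  have hint : Integrable (fun ω => ‖disagreement (runState W γ q C ξ g t ω).1‖) P :=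
    memLp_one_iff_integrable.1 ⟨hmeas, h1.trans_lt ENNReal.ofReal_lt_top⟩
  refine ⟨hint, ?_⟩
  have hdv : d ≤ roundBound (trackerRate γ ρ) ((2 + (1 - ρ) / 4) * √N) q t := by
    have : 0 ≤ (1 - ρ) / 4 * e := mul_nonneg (by linarith [hρ.lt_one]) he0
    linarith
  refine le_trans ?_ hdv
  rw [← ENNReal.ofReal_le_ofReal_iff hd0,
    ofReal_integral_eq_lintegral_ofReal hint (Filter.Eventually.of_forall fun _ => norm_nonneg _)]
  refine le_trans (le_of_eq ?_) h1
  rw [eLpNorm_one_eq_lintegral_enorm]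
  exact lintegral_congr fun ω => by rw [Real.enorm_of_nonneg (norm_nonneg _)]

/-- Expected regret of a run whose gossip schedule beats the growth of the Lipschitz constants of
the betting functions: the disagreement costs form a geometric series. -/
theorem IsDecoRun.integral_decoRegret_le (hW : IsGossipMatrix 𝒢 W) (hN : 0 < N)
    (hρ : IsContractionFactor W ρ) (hC : IsCompressor ν C α) (hγ0 : 0 < γ)
    (hγ : γ ≤ maxStepSize α ρ) (hF : IsBettingPotential F ε) {L : ℕ → ℝ} (hL : ∀ t, 0 ≤ L t)
    (hlip : ∀ (t : ℕ) (x y : ℝ), 0 ≤ y → y ≤ x → x ≤ t →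
      |coinBet F (t + 1) x - coinBet F (t + 1) y| ≤ L t * (x - y))
    {θ K : ℝ} (hθ0 : 0 < θ) (hθ : θ ≤ 1 / 2) (hq : ∀ t, trackerRate γ ρ ^ q t ≤ θ ^ t)
    (hK : ∀ t, L t * (2 * θ ^ t) ≤ θ * (K * (1 / 2) ^ t)) (hK0 : 0 ≤ K)
    (hrun : IsDecoRun ν P 𝓕 F W γ q C ξ l g) (T : ℕ) {a b : ℝ} (ha : 0 < a) (hb : 0 < b)
    (hlow : ∀ x : ℝ, 0 ≤ x → x ≤ T → b * Real.exp (x ^ 2 / (2 * a)) ≤ F T x) (u : H) :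
    ∫ ω, decoRegret F W γ q C ξ l g T u ω ∂P ≤
      ‖u‖ * √(a * Real.log (1 + a * ‖u‖ ^ 2 / b ^ 2)) + (ε - b) +
        3 * ((2 + (1 - ρ) / 4) * √N * (2 * K)) := by
  have hμ0 : 0 < 1 - ρ := by linarith [hρ.lt_one]
  obtain ⟨B, hB⟩ : ∃ B, B = (2 + (1 - ρ) / 4) * √N := ⟨_, rfl⟩
  have hB0 : 0 ≤ B := by rw [hB]; positivity
  have hη : 0 ≤ trackerRate γ ρ := by
    have : γ ≤ 1 := hγ.trans (min_le_left _ _)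
    rw [trackerRate]
    nlinarith [hρ.nonneg]
  have hdis := fun t => hrun.integral_norm_disagreement_le hW hN hρ hC hγ0 hγ t
  have hterm : ∀ t, L t * roundBound (trackerRate γ ρ) B q t ≤ B * K * (1 / 2) ^ t := fun t => by
    have h1 := mul_le_mul_of_nonneg_left (roundBound_le hη hB0 hθ0.le hθ hq t) (hL t)
    have h2 := mul_le_mul_of_nonneg_left (hK t) hB0
    refine le_of_mul_le_mul_left ?_ hθ0
    linarith
  have hgeom : ∑ t ∈ Finset.range T, ((1 : ℝ) / 2) ^ t ≤ 2 := sum_geometric_two_le T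
  have hbound : Integrable (fun ω => ‖u‖ * √(a * Real.log (1 + a * ‖u‖ ^ 2 / b ^ 2)) + (ε - b) +
      3 * ∑ t ∈ Finset.range T, L t * ‖disagreement (runState W γ q C ξ g t ω).1‖) P :=
    (integrable_const _).add
      ((integrable_finsetSum _ fun t _ => (hdis t).1.const_mul (L t)).const_mul 3)
  calc ∫ ω, decoRegret F W γ q C ξ l g T u ω ∂P
      ≤ ∫ ω, (‖u‖ * √(a * Real.log (1 + a * ‖u‖ ^ 2 / b ^ 2)) + (ε - b) +
          3 * ∑ t ∈ Finset.range T, L t * ‖disagreement (runState W γ q C ξ g t ω).1‖) ∂P :=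
        integral_mono (hrun.integrable_decoRegret hW hN hρ hC hγ0 hγ hF hL hlip T u) hbound
          fun ω => networkRegret_le hW hN hF hL hlip (fun t n => hrun.loss_lipschitz t n ω)
            (fun t n => hrun.grad_subgradient t n ω) T ha hb hlow u
    _ = ‖u‖ * √(a * Real.log (1 + a * ‖u‖ ^ 2 / b ^ 2)) + (ε - b) +
          3 * ∑ t ∈ Finset.range T,
            L t * ∫ ω, ‖disagreement (runState W γ q C ξ g t ω).1‖ ∂P := by
        rw [integral_add (integrable_const _)
          ((integrable_finsetSum _ fun t _ => (hdis t).1.const_mul (L t)).const_mul 3),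
          integral_const_mul, integral_finsetSum _ fun t _ => (hdis t).1.const_mul (L t)]
        simp only [integral_const_mul, integral_const, probReal_univ, one_smul]
    _ ≤ ‖u‖ * √(a * Real.log (1 + a * ‖u‖ ^ 2 / b ^ 2)) + (ε - b) +
          3 * ∑ t ∈ Finset.range T, B * K * (1 / 2) ^ t := by
        have hsum := Finset.sum_le_sum fun t (_ : t ∈ Finset.range T) =>
          (mul_le_mul_of_nonneg_left (hB ▸ (hdis t).2) (hL t)).trans (hterm t)
        linarith
    _ ≤ ‖u‖ * √(a * Real.log (1 + a * ‖u‖ ^ 2 / b ^ 2)) + (ε - b) + 3 * (B * (2 * K)) := by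
        rw [← Finset.mul_sum]
        have := mul_le_mul_of_nonneg_left hgeom (mul_nonneg hB0 hK0)
        linarith
    _ = _ := by rw [hB]

end Expectation

/-! ### Schedules and constants -/

/-- The schedule `⌈c t⌉` with `c ≥ -κ / log η` makes `q t` substeps at rate `η` contract by
`exp (-κ t)`. -/
lemma trackerRate_pow_linearSchedule_le {γ ρ : ℝ} (hγ0 : 0 < γ) (hγ1 : γ ≤ 1) (hρ0 : 0 ≤ ρ)
    (hρ1 : ρ < 1) {κ c : ℝ} (hc : -κ / Real.log (trackerRate γ ρ) ≤ c) (t : ℕ) :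
    trackerRate γ ρ ^ linearSchedule c t ≤ Real.exp (-κ) ^ t := by
  have hη0 : 0 < trackerRate γ ρ := by rw [trackerRate]; nlinarith
  have hη1 : trackerRate γ ρ < 1 := by rw [trackerRate]; nlinarith
  have hlog : Real.log (trackerRate γ ρ) < 0 := Real.log_neg hη0 hη1
  rw [div_le_iff_of_neg hlog] at hc
  have hceil : c * t ≤ linearSchedule c t := Nat.le_ceil _
  have ht : (0 : ℝ) ≤ t := Nat.cast_nonneg t
  rw [← Real.exp_log (pow_pos hη0 (linearSchedule c t)), Real.log_pow, ← Real.exp_nat_mul,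
    Real.exp_le_exp]
  nlinarith

lemma mul_le_regConst_mul_sqrt {Csched ρ K : ℝ} {N T : ℕ} (hρ1 : ρ < 1) (hT : 0 < T)
    (hK0 : 0 ≤ K) (hK : 2 * K ≤ Csched / 2) :
    3 * ((2 + (1 - ρ) / 4) * √N * (2 * K)) ≤ regConst Csched ρ N * √T := by
  have hT1 : 1 ≤ √(T : ℝ) := Real.one_le_sqrt.2 (by exact_mod_cast hT)
  have hμ : 0 ≤ 2 + (1 - ρ) / 4 := by linarith
  rw [regConst, netConst]
  calc 3 * ((2 + (1 - ρ) / 4) * √N * (2 * K))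
      ≤ 3 * ((2 + (1 - ρ) / 4) * √N * (Csched / 2)) := by gcongr
    _ = 3 * ((2 + (1 - ρ) / 4) * (Csched / 2) * √N) * 1 := by ring
    _ ≤ _ := by
        gcongr
        have : 0 ≤ Csched / 2 := by linarith
        positivity

theorem mainTheorem2
    {H : Type*} [NormedAddCommGroup H] [InnerProductSpace ℝ H] [CompleteSpace H]
    [MeasurableSpace H] [BorelSpace H]
    {N : ℕ} (𝒢 : SimpleGraph (Fin N)) (h𝒢 : 𝒢.Connected)
    (W : Matrix (Fin N) (Fin N) ℝ) (hW : IsGossipMatrix 𝒢 W)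
    {Ξ : Type*} [MeasurableSpace Ξ] (ν : Measure Ξ) [IsProbabilityMeasure ν]
    (C : Ξ → H → H) (α : ℝ) (hC : IsCompressor ν C α)
    {Ω : Type*} {mΩ : MeasurableSpace Ω} (P : Measure Ω) [IsProbabilityMeasure P]
    (𝓕 : Filtration ℕ mΩ) (ξ : ℕ → ℕ → Fin N → Ω → Ξ)
    (l : ℕ → Fin N → Ω → H → ℝ) (g : ℕ → Fin N → Ω → H)
    (ε : ℝ) (hε : 0 < ε) :
    (∃ ρ : ℝ, IsContractionFactor W ρ) ∧
    ∀ ρ : ℝ, IsContractionFactor W ρ →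
    ∀ γ : ℝ, 0 < γ → γ ≤ maxStepSize α ρ →
    ∀ c : ℝ,
      (-(2 * Real.log 2) / Real.log (trackerRate γ ρ) ≤ c →
        IsDecoRun ν P 𝓕 (ktPotential ε) W γ (linearSchedule c) C ξ l g →
        ∀ (u : H) (T : ℕ), 0 < T →
          Integrable (decoRegret (ktPotential ε) W γ (linearSchedule c) C ξ l g T u) P ∧
          ∫ ω, decoRegret (ktPotential ε) W γ (linearSchedule c) C ξ l g T u ω ∂P ≤
            ‖u‖ * Real.sqrt (2 * ((T : ℝ) + 1))
                * Real.sqrt (Real.log (1 +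
                    2 * Real.exp 1 ^ 2 * Real.pi * (T : ℝ) * ((T : ℝ) + 1) * ‖u‖ ^ 2 / ε ^ 2))
              + ε * (1 - 1 / (Real.exp 1 * Real.sqrt (Real.pi * (T : ℝ))))
              + regConst (schedConstKT ε) ρ N * Real.sqrt (T : ℝ)) ∧
      (-3 / (2 * Real.log (trackerRate γ ρ)) ≤ c →
        IsDecoRun ν P 𝓕 (sePotential ε) W γ (linearSchedule c) C ξ l g →
        ∀ (u : H) (T : ℕ), 0 < T →
          Integrable (decoRegret (sePotential ε) W γ (linearSchedule c) C ξ l g T u) P ∧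
          ∫ ω, decoRegret (sePotential ε) W γ (linearSchedule c) C ξ l g T u ω ∂P ≤
            ‖u‖ * Real.sqrt (((T : ℝ) + 1)
                * Real.log (1 + ((T : ℝ) + 1) ^ 2 * ‖u‖ ^ 2 / ε ^ 2))
              + ε * (1 - 1 / Real.sqrt ((T : ℝ) + 1))
              + regConst (schedConstSE ε) ρ N * Real.sqrt (T : ℝ)) := by
  have hN : 0 < N := by
    obtain ⟨n⟩ := h𝒢.nonempty
    exact Fin.pos n
  refine ⟨hW.exists_isContractionFactor h𝒢, fun ρ hρ γ hγ0 hγ c => ⟨?_, ?_⟩⟩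
  · intro hc hrun u T hT
    have hF := isBettingPotential_ktPotential hε
    have hL : ∀ t : ℕ, 0 ≤ 3 * ε * 2 ^ t := fun t => by positivity
    have hlip := coinBet_ktPotential_lipschitz hε
    refine ⟨hrun.integrable_decoRegret hW hN hρ hC hγ0 hγ hF hL hlip T u, ?_⟩
    have hT0 : (0 : ℝ) < T := Nat.cast_pos.2 hT
    have hexp : Real.exp (-(2 * Real.log 2)) = 1 / 4 := by
      rw [Real.exp_neg, two_mul, Real.exp_add, Real.exp_log two_pos]
      norm_num
    have hq := trackerRate_pow_linearSchedule_le hγ0 (hγ.trans (min_le_left _ _)) hρ.nonneg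
      hρ.lt_one hc
    rw [hexp] at hq
    have hmain := hrun.integral_decoRegret_le hW hN hρ hC hγ0 hγ hF hL hlip (θ := 1 / 4)
      (K := 24 * ε) (by norm_num) (by norm_num) hq (fun t => by
        rw [show ((1 : ℝ) / 4) ^ t = (1 / 2) ^ t * (1 / 2) ^ t by rw [← mul_pow]; norm_num]
        have h2 : (2 : ℝ) ^ t * (1 / 2) ^ t = 1 := by rw [← mul_pow]; norm_num
        refine le_of_eq ?_
        linear_combination 6 * ε * (1 / 2) ^ t * h2) (by positivity) T
      (a := 2 * ((T : ℝ) + 1)) (b := ε / (Real.exp 1 * √(Real.pi * T))) (by positivity)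
      (by positivity) (ktPotential_lower hε T hT) u
    have hconst := mul_le_regConst_mul_sqrt (Csched := schedConstKT ε) (ρ := ρ) (N := N) (T := T)
      (K := 24 * ε) hρ.lt_one hT (by positivity) (by
        have hlog0 : 0 < Real.log 2 := Real.log_pos one_lt_two
        have hlog1 : 1 ≤ 1 / Real.log 2 := by
          rw [le_div_iff₀ hlog0, one_mul]
          linarith [Real.log_le_sub_one_of_pos (two_pos (α := ℝ))]
        have h2 : 2 / Real.log 2 = 2 * (1 / Real.log 2) := by ring
        rw [schedConstKT, h2]
        nlinarith)
    have hb2 : 2 * ((T : ℝ) + 1) * ‖u‖ ^ 2 / (ε / (Real.exp 1 * √(Real.pi * T))) ^ 2 =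
        2 * Real.exp 1 ^ 2 * Real.pi * T * ((T : ℝ) + 1) * ‖u‖ ^ 2 / ε ^ 2 := by
      rw [div_pow, mul_pow, Real.sq_sqrt (by positivity)]
      field_simp
    rw [hb2, Real.sqrt_mul (by positivity)] at hmain
    have hb1 : ε - ε / (Real.exp 1 * √(Real.pi * T)) =
        ε * (1 - 1 / (Real.exp 1 * √(Real.pi * T))) := by ring
    rw [hb1] at hmain
    linarith
  · intro hc hrun u T hT
    have hF := isBettingPotential_sePotential hε
    have hL : ∀ t : ℕ, 0 ≤ ε * Real.exp (t / 2) := fun t => by positivity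
    have hlip := coinBet_sePotential_lipschitz hε
    refine ⟨hrun.integrable_decoRegret hW hN hρ hC hγ0 hγ hF hL hlip T u, ?_⟩
    have hhalf : Real.exp (-1) ≤ 1 / 2 := by
      rw [Real.exp_neg, one_div]
      exact inv_anti₀ two_pos (by linarith [Real.add_one_le_exp (1 : ℝ)])
    have hc' : -(3 / 2) / Real.log (trackerRate γ ρ) ≤ c := by
      convert hc using 1
      rw [← div_div]
      ring
    have hq := trackerRate_pow_linearSchedule_le hγ0 (hγ.trans (min_le_left _ _)) hρ.nonneg
      hρ.lt_one hc'
    have hmain := hrun.integral_decoRegret_le hW hN hρ hC hγ0 hγ hF hL hlip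
      (θ := Real.exp (-(3 / 2))) (K := 2 * ε * Real.exp (3 / 2)) (Real.exp_pos _)
      ((Real.exp_le_exp.2 (by norm_num)).trans hhalf) hq (fun t => by
        have h1 : Real.exp (t / 2) * Real.exp (-(3 / 2)) ^ t = Real.exp (-1) ^ t := by
          rw [← Real.exp_nat_mul, ← Real.exp_nat_mul, ← Real.exp_add]
          ring_nf
        have h2 : Real.exp (-(3 / 2)) * Real.exp (3 / 2) = 1 := by
          rw [← Real.exp_add]; simp
        have h3 : Real.exp (-1) ^ t ≤ (1 / 2) ^ t :=
          pow_le_pow_left₀ (Real.exp_pos _).le hhalf t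
        calc ε * Real.exp (t / 2) * (2 * Real.exp (-(3 / 2)) ^ t)
            = 2 * ε * Real.exp (-1) ^ t := by rw [← h1]; ring
          _ ≤ 2 * ε * (1 / 2) ^ t := by gcongr
          _ = _ := by linear_combination (-2 * ε * (1 / 2) ^ t) * h2) (by positivity) T
      (a := (T : ℝ) + 1) (b := ε / √((T : ℝ) + 1)) (by positivity) (by positivity)
      (fun x _ _ => le_rfl) u
    have hconst := mul_le_regConst_mul_sqrt (Csched := schedConstSE ε) (ρ := ρ) (N := N) (T := T)
      (K := 2 * ε * Real.exp (3 / 2)) hρ.lt_one hT (by positivity) (by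
        rw [schedConstSE]
        linarith [Real.exp_pos (3 / 2)])
    have hb2 : ((T : ℝ) + 1) * ‖u‖ ^ 2 / (ε / √((T : ℝ) + 1)) ^ 2 =
        ((T : ℝ) + 1) ^ 2 * ‖u‖ ^ 2 / ε ^ 2 := by
      rw [div_pow, Real.sq_sqrt (by positivity)]
      field_simp
    have hb1 : ε - ε / √((T : ℝ) + 1) = ε * (1 - 1 / √((T : ℝ) + 1)) := by ring
    rw [hb2, hb1] at hmain
    linarith
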